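/- View planar loops as compact subsets of $\mathbb{C}$ with the Hausdorff topology, write $|S|$ for the diameter of $S$ and, for $S\subset\mathbb C$, let $\mathcal{A}(S)$ be the area of the complement of the unbounded connected component of $\mathbb{C}\setminus S$ (for unbounded $S$, of the complement of the union of all unbounded components). Let $\pi$ be a finite measure supported on simple loops of diameter $1$ contained in the square $[-1,1]^2$, and let $\mu$ be the image of the measure $d^2z\otimes\frac{d\rho}{\rho}\otimes\pi(d\gamma)$ on $\mathbb{R}^2\times(0,\infty)\times\{\text{loops}\}$ under $(z,\rho,\gamma)\mapsto\rho(z+\gamma)$; this is a scale- and translation-invariant measure on loops. Put $\beta(\pi)=\int\mathcal{A}(\gamma)\,\pi(d\gamma)$. For each $c>0$ let $\Gamma_c$ be a Poisson point process of loops in the whole plane with intensity $c\mu$ and law $P_c$, and let $\Gamma'_c$ be the set of loops of $\Gamma_c$ of diameter smaller than $1$. Two loops are called linked if they intersect and their interiors intersect; a cluster of a collection of loops is the union of all the loops in one class of the equivalence relation generated by linking inside the collection. Sample $(\gamma,\Gamma_c)$ from $\pi\otimes P_c$ and let $\gamma^*$ be the filling of the cluster of $\{\gamma\}\cup\Gamma'_c$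 that contains $\gamma$, i.e. the closure of the complement of the unbounded connected component of the complement of this cluster (again with the union of all unbounded components if the cluster is unbounded). Let $\beta^*(c)=\int\mathcal{A}(\gamma^*)\,d(\pi\otimes P_c)$. Then: 1. When $c$ is small enough, $\mathcal{A}(\gamma^*)$ is a $\pi\otimes P_c$-measurable function and $\beta^*(c)<\infty$. 2. $\beta(\pi)<\infty$, and $\beta^*(c)\to\beta(\pi)$ as $c\to0+$. 3. There exist $c_1>0$ and $k$ such that for all $0<c<c_1$ and all $x>4$, the probability that some cluster of $\Gamma'_c$ crosses the ring $\{z:4<|z|<x\}$ (meets both of its boundary circles) is at most $k\,x^{-4}$. -/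

import Mathlib

open MeasureTheory ProbabilityTheory Filter Topology TopologicalSpace Set
open scoped ENNReal NNReal

/-- Planar curves are viewed as nonempty compact subsets of the plane, with the Hausdorff
topology. -/
abbrev PlanarCompact : Type := NonemptyCompacts ℂ

noncomputable instance planarCompactMeasurableSpace : MeasurableSpace PlanarCompact := borel _

instance planarCompactBorelSpace : BorelSpace PlanarCompact := ⟨rfl⟩

/-- A simple loop: the image of an injective continuous map from the unit circle to the plane. -/
def IsSimpleLoop (γ : PlanarCompact) : Prop :=
  ∃ f : Circle → ℂ, Continuous f ∧ Function.Injective f ∧ Set.range f = (γ : Set ℂ)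

/-- The set surrounded by `S`: the complement of the unbounded connected component of the
complement of `S`. (If there are several unbounded components, which does not happen for
bounded `S`, the complement of their union.) -/
def filling (S : Set ℂ) : Set ℂ :=
  {z | z ∈ S ∨ Bornology.IsBounded (connectedComponentIn Sᶜ z)}

/-- The interior of a loop `S`: the bounded part of the complement of `S`. -/
def loopInterior (S : Set ℂ) : Set ℂ := filling S \ S

/-- The area of the set surrounded by `S`. -/
noncomputable def surroundedArea (S : Set ℂ) : ℝ≥0∞ := volume (filling S)

/-- The curve `ρ (z + γ)`. -/
noncomputable def translateScale (z : ℂ) (ρ : ℝ) (γ : PlanarCompact) : PlanarCompact :=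
  NonemptyCompacts.map (fun w : ℂ => (ρ : ℂ) * (z + w)) (by fun_prop) γ

/-- The push-forward that defines `soupMeasure` is along a measurable map. -/
theorem measurable_translateScale :
    Measurable (fun p : ℂ × ℝ × PlanarCompact => translateScale p.1 p.2.1 p.2.2) := by
  have h : Continuous (fun p : ℂ × ℝ × PlanarCompact => translateScale p.1 p.2.1 p.2.2) := by
    unfold translateScale
    exact Continuous.nonemptyCompacts_map'
      (f := fun p : ℂ × ℝ × PlanarCompact => p.2.2)
      (g := fun (p : ℂ × ℝ × PlanarCompact) (w : ℂ) => (p.2.1 : ℂ) * (p.1 + w))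
      (by fun_prop) (by unfold Function.uncurry; fun_prop)
  exact h.measurable

/-- The scale- and translation-invariant measure `μ` built from the shape measure `π`: the image
of `d²z ⊗ dρ/ρ ⊗ π(dγ)` on `ℝ² × (0, ∞) × {curves}` under `(z, ρ, γ) ↦ ρ (z + γ)`. -/
noncomputable def soupMeasure (π : Measure PlanarCompact) : Measure PlanarCompact :=
  Measure.map (fun p : ℂ × ℝ × PlanarCompact => translateScale p.1 p.2.1 p.2.2)
    ((volume : Measure ℂ).prod
      ((((volume : Measure ℝ).restrict (Ioi 0)).withDensity
        (fun ρ => ENNReal.ofReal ρ⁻¹)).prod π))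

/-- `π` is supported on simple loops of diameter `1` contained in the square `[-1,1]²`. -/
def IsShapeMeasure (π : Measure PlanarCompact) : Prop :=
  ∀ᵐ γ ∂π, IsSimpleLoop γ ∧ Metric.diam (γ : Set ℂ) = 1 ∧
    (γ : Set ℂ) ⊆ Icc (-1 : ℝ) 1 ×ℂ Icc (-1 : ℝ) 1

section Soups

variable {Ω : Type*}

/-- The number of curves in `A` of the countable random collection `(X j, j ∈ J)`. -/
noncomputable def soupCount (J : Ω → Set ℕ) (X : ℕ → Ω → PlanarCompact)
    (A : Set PlanarCompact) (ω : Ω) : ℕ∞ :=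
  {j | j ∈ J ω ∧ X j ω ∈ A}.encard

/-- The random countable collection of curves `(X j, j ∈ J)` (the index set `J` being random too)
is a Poisson point process with intensity `ν`. -/
structure IsPoissonSoup [MeasurableSpace Ω] (P : Measure Ω) (ν : Measure PlanarCompact)
    (J : Ω → Set ℕ) (X : ℕ → Ω → PlanarCompact) : Prop where
  measurableSet_index : ∀ j, MeasurableSet {ω | j ∈ J ω}
  measurable_curve : ∀ j, Measurable (X j)
  law_of_finite : ∀ A, MeasurableSet A → ν A ≠ ∞ →
    P.map (soupCount J X A) = (poissonMeasure (ν A).toNNReal).map (fun n : ℕ => (n : ℕ∞))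
  law_of_infinite : ∀ A, MeasurableSet A → ν A = ∞ → ∀ᵐ ω ∂P, soupCount J X A ω = ⊤
  indep : ∀ (n : ℕ) (A : Fin n → Set PlanarCompact), (∀ i, MeasurableSet (A i)) →
    Pairwise (fun i j => Disjoint (A i) (A j)) → iIndepFun (fun i => soupCount J X (A i)) P

/-- The curves of the collection with diameter smaller than `1`. -/
def smallLoops (J : Ω → Set ℕ) (X : ℕ → Ω → PlanarCompact) (ω : Ω) : Set PlanarCompact :=
  {γ | (∃ j ∈ J ω, X j ω = γ) ∧ Metric.diam (γ : Set ℂ) < 1}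

end Soups

/-- Two loops are linked if the loops intersect and their interiors intersect. -/
def Linked (γ γ' : PlanarCompact) : Prop :=
  ((γ : Set ℂ) ∩ γ').Nonempty ∧ (loopInterior (γ : Set ℂ) ∩ loopInterior (γ' : Set ℂ)).Nonempty

/-- The cluster of the loop `γ ∈ S` in the collection `S`: the union of all the loops that are
joined to `γ` by a finite chain of successively linked loops of `S`. -/
def clusterOf (S : Set PlanarCompact) (γ : PlanarCompact) : Set ℂ :=
  ⋃ γ' ∈ {γ' | Relation.ReflTransGen (fun a b => b ∈ S ∧ Linked a b) γ γ'}, (γ' : Set ℂ)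

/-- `γ*`: the filling (closure of the complement of the unbounded connected component of the
complement) of the cluster of `γ` in `{γ} ∪ S`. -/
def filledCluster (S : Set PlanarCompact) (γ : PlanarCompact) : Set ℂ :=
  closure (filling (clusterOf (insert γ S) γ))

/-- Some cluster of the collection `S` crosses the ring `{z : r < |z| < x}`, that is, meets both
of its boundary circles. -/
def HasCrossingCluster (S : Set PlanarCompact) (r x : ℝ) : Prop :=
  ∃ γ ∈ S, (clusterOf S γ ∩ Metric.sphere 0 r).Nonempty ∧
    (clusterOf S γ ∩ Metric.sphere 0 x).Nonempty

/-- `β(π) = π(𝒜(γ))`. -/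
noncomputable def meanArea (π : Measure PlanarCompact) : ℝ≥0∞ :=
  ∫⁻ γ, surroundedArea (γ : Set ℂ) ∂π

/-- The area of `γ*` as a function of the pair (loop `γ`, realization `ω` of the soup). -/
noncomputable def starArea {Ω : Type*} (J : Ω → Set ℕ) (X : ℕ → Ω → PlanarCompact)
    (p : PlanarCompact × Ω) : ℝ≥0∞ :=
  surroundedArea (filledCluster (smallLoops J X p.2) p.1)

/-- `β* = π*(𝒜(γ*))`: the integral of the area of `γ*` under the product of `π` and the law of
the soup. -/
noncomputable def meanStarArea (π : Measure PlanarCompact) {Ω : Type*} [MeasurableSpace Ω]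
    (P : Measure Ω) (J : Ω → Set ℕ) (X : ℕ → Ω → PlanarCompact) : ℝ≥0∞ :=
  ∫⁻ p, starArea J X p ∂(π.prod P)

/-! ### Fillings of planar sets -/

/-! The soup is dominated by a multiscale percolation of discs. A loop of diameter in `[16^(-k-1),
16^(-k))` is put in a cell of level `k`, the first disc of radius `2 * 16^(-k)` with center in a
fixed dense sequence that contains it; a cell is open if it received a loop. Distinct cells
correspond to disjoint sets of loops, so they are open independently
(`IsPoissonSoup.iIndep_openCells`). Scale invariance bounds the probability of an open cell of level
`n` near a point by `a = c * levelMass π`, uniformly in the level and the point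
(`soupMeasure_level_le`).

Let `p n` bound the probability that a chain of touching open cells of level at least `n` joins a
disc of radius `r = 16^(-n)` to the outside of its double. Without an open cell of level `n` nearby,
both ends of the chain produce crossings of scale `n + 1`, around points so far apart that they
depend on disjoint sets of cells. With `N` points in a net this gives `p n ≤ a + N² p (n+1)²`
(`measure_crosses_le_succ`), hence `p n ≤ 2a` for small `a`. Loops of diameter less than `1` have
nonnegative level, so above scale `1` the term `a` disappears, and `p (-j) ≤ 2a * 16^(-4j)`. This
decay gives the bound on ring crossings. It also beats the growth `256^j` of the area of a disc of
radius of order `16^j`, whence the finite mean.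

For the limit, the cluster contains `γ`, which gives the lower bound. For the upper bound fix a
small scale `16^(-n)`: outside an event of probability `O(c)` the cluster stays in the `3 * 16^(-n)`
thickening of `γ`, and the remaining contribution to the mean is also `O(c)` (`starArea_le`,
`IsPoissonSoup.meanStarArea_le`). Let first `c → 0`, then `n → ∞`; the area surrounded by a
thickening of a compact set decreases to that of the set.

Measurability rests on the same continuity from above: it makes the surrounded area upper
semicontinuous, and it expresses the area of a bounded cluster through finite unions of loops
(`surroundedArea_closure_iUnion`). -/

theorem subset_filling (S : Set ℂ) : S ⊆ filling S := fun _ hz => Or.inl hz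

/-- Any unbounded connected set avoiding `S` is a witness, so components need not be computed
afterwards. -/
theorem notMem_filling_iff {S : Set ℂ} {z : ℂ} :
    z ∉ filling S ↔
      ∃ C : Set ℂ, IsPreconnected C ∧ z ∈ C ∧ C ⊆ Sᶜ ∧ ¬ Bornology.IsBounded C := by
  constructor
  · intro h
    have h' : z ∉ S ∧ ¬ Bornology.IsBounded (connectedComponentIn Sᶜ z) := by
      simpa [filling, not_or] using h
    exact ⟨_, isPreconnected_connectedComponentIn, mem_connectedComponentIn h'.1,
      connectedComponentIn_subset _ _, h'.2⟩
  · rintro ⟨C, hC, hz, hCS, hb⟩ (h | h)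
    · exact hCS hz h
    · exact hb (h.subset (hC.subset_connectedComponentIn hz hCS))

theorem filling_mono {S T : Set ℂ} (h : S ⊆ T) : filling S ⊆ filling T := by
  intro z
  contrapose
  simp only [notMem_filling_iff]
  rintro ⟨C, hC, hz, hCS, hb⟩
  exact ⟨C, hC, hz, hCS.trans (compl_subset_compl.2 h), hb⟩

theorem connectedComponentIn_subset_compl_filling {S : Set ℂ} {z : ℂ} (hz : z ∉ filling S) :
    connectedComponentIn Sᶜ z ⊆ (filling S)ᶜ := by
  have h' : z ∉ S ∧ ¬ Bornology.IsBounded (connectedComponentIn Sᶜ z) := by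
    simpa [filling, not_or] using hz
  intro w hw
  rw [mem_compl_iff, notMem_filling_iff]
  exact ⟨_, isPreconnected_connectedComponentIn, hw, connectedComponentIn_subset _ _, h'.2⟩

theorem filling_filling (S : Set ℂ) : filling (filling S) = filling S := by
  refine Subset.antisymm ?_ (subset_filling _)
  intro z
  contrapose
  intro hz
  have h' : z ∉ S ∧ ¬ Bornology.IsBounded (connectedComponentIn Sᶜ z) := by
    simpa [filling, not_or] using hz
  exact notMem_filling_iff.2 ⟨_, isPreconnected_connectedComponentIn,
    mem_connectedComponentIn h'.1, connectedComponentIn_subset_compl_filling hz, h'.2⟩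

theorem IsClosed.filling {S : Set ℂ} (hS : IsClosed S) : IsClosed (filling S) := by
  rw [← isOpen_compl_iff, isOpen_iff_forall_mem_open]
  intro z hz
  exact ⟨_, connectedComponentIn_subset_compl_filling hz, hS.isOpen_compl.connectedComponentIn,
    mem_connectedComponentIn fun h => hz (subset_filling _ h)⟩

/-- Allows the closed filling in `γ*` to be replaced by the closure of the cluster itself, which is
compact when the cluster is bounded. -/
theorem filling_closure_filling (S : Set ℂ) :
    filling (closure (filling S)) = filling (closure S) := by
  refine Subset.antisymm ?_ (filling_mono (closure_mono (subset_filling S)))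
  have h : closure (filling S) ⊆ filling (closure S) :=
    closure_minimal (filling_mono subset_closure) isClosed_closure.filling
  simpa [filling_filling] using filling_mono h

theorem isPreconnected_setOf_lt_norm {M : ℝ} (hM : 0 < M) :
    IsPreconnected {w : ℂ | M < ‖w‖} := by
  have h : {w : ℂ | M < ‖w‖} = Complex.exp '' {s : ℂ | Real.log M < s.re} := by
    ext w
    constructor
    · intro hw
      have hw0 : w ≠ 0 := by
        rintro rfl
        simp at hw
        linarith
      refine ⟨Complex.log w, ?_, Complex.exp_log hw0⟩
      simpa [Complex.log_re] using Real.log_lt_log hM hw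
    · rintro ⟨s, hs, rfl⟩
      simpa [Complex.norm_exp] using (Real.log_lt_iff_lt_exp hM).1 hs
  rw [h]
  exact ((convex_halfSpace_re_gt _).isPreconnected).image _ Complex.continuous_exp.continuousOn

theorem not_isBounded_setOf_lt_norm (M : ℝ) : ¬ Bornology.IsBounded {w : ℂ | M < ‖w‖} := by
  intro h
  obtain ⟨R, hR⟩ := h.exists_norm_le
  have h1 := hR ((|M| + |R| + 1 : ℝ) : ℂ) (by
    rw [mem_ofPred_eq, Complex.norm_real, Real.norm_of_nonneg (by positivity)]
    linarith [le_abs_self M, abs_nonneg R])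
  rw [Complex.norm_real, Real.norm_of_nonneg (by positivity)] at h1
  linarith [le_abs_self R, abs_nonneg M]

theorem filling_subset_closedBall {S : Set ℂ} {M : ℝ} (hM : 0 < M)
    (hS : S ⊆ Metric.closedBall 0 M) : filling S ⊆ Metric.closedBall 0 M := by
  intro z
  contrapose
  intro hz
  refine notMem_filling_iff.2 ⟨_, isPreconnected_setOf_lt_norm hM, by simpa using hz, ?_,
    not_isBounded_setOf_lt_norm M⟩
  intro w hw hwS
  have := hS hwS
  simp at this
  exact absurd hw (not_lt.2 this)

/-- Escape is stable: a path from `z` to a point far away is compact, hence at positive distance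
from `K`, and it continues into the exterior of a large disc. -/
theorem exists_notMem_filling_cthickening {K : Set ℂ} (hK : IsCompact K) {z : ℂ}
    (hz : z ∉ filling K) : ∃ η > 0, z ∉ filling (Metric.cthickening η K) := by
  have h' : z ∉ K ∧ ¬ Bornology.IsBounded (connectedComponentIn Kᶜ z) := by
    simpa [filling, not_or] using hz
  obtain ⟨M, hM0, hM⟩ := hK.isBounded.exists_pos_norm_le
  obtain ⟨q, hqU, hq⟩ : ∃ q ∈ connectedComponentIn Kᶜ z, M + 1 < ‖q‖ := by
    by_contra! hcon
    exact h'.2 (Bornology.IsBounded.subset Metric.isBounded_closedBall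
      (fun w hw => by simpa using hcon w hw : _ ⊆ Metric.closedBall (0 : ℂ) (M + 1)))
  have hUo : IsOpen (connectedComponentIn Kᶜ z) := hK.isClosed.isOpen_compl.connectedComponentIn
  have hUc : IsConnected (connectedComponentIn Kᶜ z) :=
    isConnected_connectedComponentIn_iff.2 h'.1
  obtain ⟨p, hp⟩ := (hUo.isConnected_iff_isPathConnected.1 hUc).joinedIn z
    (mem_connectedComponentIn h'.1) q hqU
  have hpc : IsCompact (range p) := isCompact_range p.continuous
  have hdisj : Disjoint (range p) K := by
    rw [Set.disjoint_left]
    rintro _ ⟨t, rfl⟩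
    exact connectedComponentIn_subset _ _ (hp t)
  obtain ⟨δ, hδ, hδd⟩ := hdisj.exists_cthickenings hpc hK.isClosed
  -- The bound `1` keeps the thickening within norm `M + 1`, away from the exterior region.
  refine ⟨min δ 1, by positivity, notMem_filling_iff.2
    ⟨range p ∪ {w : ℂ | M + 1 < ‖w‖}, ?_, Or.inl ⟨0, p.source⟩, ?_, fun hb =>
      not_isBounded_setOf_lt_norm _ (hb.subset subset_union_right)⟩⟩
  · exact (isPreconnected_range p.continuous).union q ⟨1, p.target⟩ hq
      (isPreconnected_setOf_lt_norm (by positivity))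
  · rintro w (hw | hw) hwK
    · exact Set.disjoint_left.1 hδd (Metric.self_subset_cthickening _ hw)
        (Metric.cthickening_mono (min_le_left _ _) _ hwK)
    · rw [hK.cthickening_eq_biUnion_closedBall (by positivity)] at hwK
      simp only [mem_iUnion, Metric.mem_closedBall, exists_prop] at hwK
      obtain ⟨y, hy, hwy⟩ := hwK
      have h1 := hM y hy
      have h2 : ‖w‖ ≤ ‖y‖ + dist w y := by
        rw [dist_eq_norm]
        simpa using norm_add_le y (w - y)
      have h3 := min_le_right δ 1
      simp only [mem_ofPred_eq] at hw
      linarith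

theorem iInter_filling_cthickening {K : Set ℂ} (hK : IsCompact K) :
    ⋂ n : ℕ, filling (Metric.cthickening (1 / ((n : ℝ) + 1)) K) = filling K := by
  refine Subset.antisymm ?_ (subset_iInter fun n => filling_mono (Metric.self_subset_cthickening _))
  intro z
  contrapose
  intro hz
  obtain ⟨η, hη, h⟩ := exists_notMem_filling_cthickening hK hz
  obtain ⟨n, hn⟩ := exists_nat_one_div_lt hη
  simp only [mem_iInter, not_forall]
  exact ⟨n, fun h2 => h (filling_mono (Metric.cthickening_mono hn.le _) h2)⟩

theorem surroundedArea_mono {S T : Set ℂ} (h : S ⊆ T) : surroundedArea S ≤ surroundedArea T :=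
  measure_mono (filling_mono h)

theorem surroundedArea_lt_top {K : Set ℂ} (hK : Bornology.IsBounded K) :
    surroundedArea K < ∞ := by
  obtain ⟨M, hM0, hM⟩ := hK.exists_pos_norm_le
  refine (measure_mono (filling_subset_closedBall hM0 ?_)).trans_lt
    (measure_closedBall_lt_top (x := (0 : ℂ)) (r := M))
  intro z hz
  simpa using hM z hz

theorem antitone_one_div_add_one : Antitone fun n : ℕ => 1 / ((n : ℝ) + 1) := by
  intro m n h
  exact one_div_le_one_div_of_le (by positivity) (by exact_mod_cast Nat.succ_le_succ h)

theorem tendsto_surroundedArea_cthickening {K : Set ℂ} (hK : IsCompact K) :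
    Tendsto (fun n : ℕ => surroundedArea (Metric.cthickening (1 / ((n : ℝ) + 1)) K)) atTop
      (𝓝 (surroundedArea K)) := by
  unfold surroundedArea
  rw [← iInter_filling_cthickening hK]
  refine tendsto_measure_iInter_atTop
    (fun n => Metric.isClosed_cthickening.filling.measurableSet.nullMeasurableSet) ?_
    ⟨0, (surroundedArea_lt_top hK.isBounded.cthickening).ne⟩
  intro m n h
  exact filling_mono (Metric.cthickening_mono (antitone_one_div_add_one h) _)

theorem surroundedArea_eq_iInf {K : Set ℂ} (hK : IsCompact K) :
    surroundedArea K =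
      ⨅ n : ℕ, surroundedArea (Metric.cthickening (1 / ((n : ℝ) + 1)) K) := by
  refine tendsto_nhds_unique (tendsto_surroundedArea_cthickening hK) (tendsto_atTop_iInf ?_)
  intro m n h
  exact surroundedArea_mono (Metric.cthickening_mono (antitone_one_div_add_one h) _)

/-! ### Measurability on the space of compact sets -/

theorem PlanarCompact.subset_cthickening_dist (K K' : PlanarCompact) :
    (K' : Set ℂ) ⊆ Metric.cthickening (dist K' K) K := by
  intro x hx
  obtain ⟨y, hy, hxy⟩ := K.isCompact.exists_infDist_eq_dist K.nonempty x
  refine Metric.mem_cthickening_of_dist_le x y _ _ hy ?_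
  rw [← hxy, Metric.NonemptyCompacts.dist_eq]
  exact Metric.infDist_le_hausdorffDist_of_mem hx
    (Metric.hausdorffEDist_ne_top_of_nonempty_of_bounded K'.nonempty K.nonempty
      K'.isCompact.isBounded K.isCompact.isBounded)

theorem PlanarCompact.cthickening_subset {K K' : PlanarCompact} {δ η : ℝ} (hδ : 0 ≤ δ)
    (hη : dist K' K ≤ η) :
    Metric.cthickening δ (K' : Set ℂ) ⊆ Metric.cthickening η (Metric.cthickening δ (K : Set ℂ)) := by
  have hη0 : 0 ≤ η := dist_nonneg.trans hη
  rw [cthickening_cthickening hη0 hδ, add_comm, ← cthickening_cthickening hδ hη0]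
  exact Metric.cthickening_subset_of_subset _
    ((PlanarCompact.subset_cthickening_dist K K').trans (Metric.cthickening_mono hη _))

/-- Upper semicontinuity: a Hausdorff perturbation stays in a slightly larger thickening, whose
surrounded area is close to the original one. Hence strict sublevel sets are open. -/
theorem measurable_surroundedArea_cthickening {δ : ℝ} (hδ : 0 ≤ δ) :
    Measurable fun K : PlanarCompact => surroundedArea (Metric.cthickening δ (K : Set ℂ)) := by
  refine measurable_of_Iio fun a => IsOpen.measurableSet (Metric.isOpen_iff.2 fun K hK => ?_)
  have h := tendsto_surroundedArea_cthickening (K.isCompact.cthickening (r := δ))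
  obtain ⟨n, hn⟩ := (h.eventually (gt_mem_nhds (show _ < a from hK))).exists
  refine ⟨1 / ((n : ℝ) + 1), by positivity, fun K' hK' => ?_⟩
  exact (surroundedArea_mono (PlanarCompact.cthickening_subset hδ
    (Metric.mem_ball.1 hK').le)).trans_lt hn

theorem measurable_surroundedArea : Measurable fun K : PlanarCompact => surroundedArea (K : Set ℂ) := by
  have h := measurable_surroundedArea_cthickening le_rfl
  simpa [Metric.cthickening_zero, fun K : PlanarCompact => K.isCompact.isClosed.closure_eq] using h

theorem isClosed_setOf_mem_filling (q : ℂ) : IsClosed {K : PlanarCompact | q ∈ filling K} := by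
  rw [← isOpen_compl_iff, Metric.isOpen_iff]
  intro K hK
  obtain ⟨η, hη, h⟩ := exists_notMem_filling_cthickening K.isCompact hK
  refine ⟨η, hη, fun K' hK' h2 => h (filling_mono ?_ h2)⟩
  exact (PlanarCompact.subset_cthickening_dist K K').trans
    (Metric.cthickening_mono (Metric.mem_ball.1 hK').le _)

theorem isClosed_setOf_mem (q : ℂ) : IsClosed {K : PlanarCompact | q ∈ (K : Set ℂ)} := by
  have h := NonemptyCompacts.isClosed_inter_nonempty_of_isClosed (isClosed_singleton (x := q))
  simpa [Set.inter_singleton_nonempty] using h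

theorem lipschitzWith_diam :
    LipschitzWith 2 fun K : PlanarCompact => Metric.diam (K : Set ℂ) := by
  refine LipschitzWith.of_le_add_mul 2 fun K K' => ?_
  calc Metric.diam (K : Set ℂ) ≤ Metric.diam (Metric.cthickening (dist K K') (K' : Set ℂ)) :=
        Metric.diam_mono (PlanarCompact.subset_cthickening_dist K' K)
          K'.isCompact.isBounded.cthickening
    _ ≤ Metric.diam (K' : Set ℂ) + 2 * dist K K' :=
        Metric.diam_cthickening_le _ dist_nonneg

theorem measurable_diam : Measurable fun K : PlanarCompact => Metric.diam (K : Set ℂ) :=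
  lipschitzWith_diam.continuous.measurable

theorem isOpen_loopInterior (K : PlanarCompact) : IsOpen (loopInterior (K : Set ℂ)) := by
  rw [isOpen_iff_forall_mem_open]
  rintro z ⟨hz | hz, hzK⟩
  · exact absurd hz hzK
  refine ⟨connectedComponentIn (K : Set ℂ)ᶜ z, fun w hw => ?_,
    K.isCompact.isClosed.isOpen_compl.connectedComponentIn, mem_connectedComponentIn hzK⟩
  refine ⟨Or.inr ?_, connectedComponentIn_subset _ _ hw⟩
  rwa [← connectedComponentIn_eq hw]

theorem isClosed_setOf_inter_nonempty :
    IsClosed {p : PlanarCompact × PlanarCompact | ((p.1 : Set ℂ) ∩ p.2).Nonempty} := by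
  rw [← isOpen_compl_iff, Metric.isOpen_iff]
  intro p hp
  obtain ⟨δ, hδ, hd⟩ := (Set.disjoint_iff_inter_eq_empty.2
    (Set.not_nonempty_iff_eq_empty.1 hp)).exists_cthickenings p.1.isCompact p.2.isCompact.isClosed
  refine ⟨δ, hδ, fun q hq hne => ?_⟩
  rw [← ball_prod_same] at hq
  obtain ⟨x, hx1, hx2⟩ := hne
  exact Set.disjoint_left.1 hd
    (Metric.cthickening_mono (Metric.mem_ball.1 hq.1).le _
      (PlanarCompact.subset_cthickening_dist p.1 q.1 hx1))
    (Metric.cthickening_mono (Metric.mem_ball.1 hq.2).le _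
      (PlanarCompact.subset_cthickening_dist p.2 q.2 hx2))

/-- Meeting is a closed condition. Interiors are open, so if they meet they do so at a point of a
fixed dense sequence, which leaves a countable union. -/
theorem measurableSet_setOf_linked :
    MeasurableSet {p : PlanarCompact × PlanarCompact | Linked p.1 p.2} := by
  have h : {p : PlanarCompact × PlanarCompact | Linked p.1 p.2} =
      {p | ((p.1 : Set ℂ) ∩ p.2).Nonempty} ∩
      ⋃ n : ℕ, {K : PlanarCompact | denseSeq ℂ n ∈ loopInterior (K : Set ℂ)} ×ˢ
        {K : PlanarCompact | denseSeq ℂ n ∈ loopInterior (K : Set ℂ)} := by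
    ext p
    simp only [Linked, mem_ofPred_eq, mem_inter_iff, mem_iUnion, mem_prod]
    refine and_congr_right fun _ => ⟨fun h => ?_, fun ⟨n, h1, h2⟩ => ⟨_, h1, h2⟩⟩
    obtain ⟨_, hx, n, rfl⟩ := (denseRange_denseSeq ℂ).inter_open_nonempty _
      ((isOpen_loopInterior p.1).inter (isOpen_loopInterior p.2)) h
    exact ⟨n, hx.1, hx.2⟩
  have h2 (q : ℂ) : MeasurableSet {K : PlanarCompact | q ∈ loopInterior (K : Set ℂ)} :=
    (isClosed_setOf_mem_filling q).measurableSet.diff (isClosed_setOf_mem q).measurableSet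
  rw [h]
  exact isClosed_setOf_inter_nonempty.measurableSet.inter
    (MeasurableSet.iUnion fun n => (h2 _).prod (h2 _))

/-! ### Chains -/

theorem Relation.ReflTransGen.of_imp {α : Type*} {r p : α → α → Prop} {a b : α}
    (h : Relation.ReflTransGen r a b) (hrp : ∀ x y, r x y → p x y) :
    Relation.ReflTransGen p a b :=
  Relation.ReflTransGen.mono hrp _ _ h

/-- Stop the chain at its first element outside `Q`; all earlier elements satisfy `Q`. -/
theorem Relation.ReflTransGen.exists_first {α : Type*} {r : α → α → Prop} {Q : α → Prop} {a b : α}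
    (h : Relation.ReflTransGen r a b) (hb : ¬ Q b) :
    ∃ b', ¬ Q b' ∧ Relation.ReflTransGen (fun x y => Q x ∧ r x y) a b' := by
  induction h using Relation.ReflTransGen.head_induction_on with
  | refl => exact ⟨b, hb, .refl⟩
  | @head x y hxy _ ih =>
    obtain ⟨b', hb', hy⟩ := ih
    by_cases hx : Q x
    · exact ⟨b', hb', hy.head ⟨hx, hxy⟩⟩
    · exact ⟨x, hx, .refl⟩

theorem Relation.ReflTransGen.reverse_of_symmetric {α : Type*} {s : α → α → Prop} {L : α → Prop}
    (hs : ∀ x y, s x y → s y x) {a b : α} (ha : L a)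
    (h : Relation.ReflTransGen (fun x y => s x y ∧ L y) a b) :
    L b ∧ Relation.ReflTransGen (fun x y => s x y ∧ L y) b a := by
  induction h with
  | refl => exact ⟨ha, .refl⟩
  | @tail y z _ hyz ih => exact ⟨hyz.2, ih.2.head ⟨hs _ _ hyz.1, ih.1⟩⟩

theorem measurableSet_reflTransGen {ι Ω : Type*} [Countable ι] [MeasurableSpace Ω]
    {r : Ω → ι → ι → Prop} (hr : ∀ i j, MeasurableSet {ω | r ω i j}) (i j : ι) :
    MeasurableSet {ω | Relation.ReflTransGen (r ω) i j} := by
  classical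
  let s : ℕ → ι → Set Ω := fun n => Nat.rec (fun j => if i = j then univ else ∅)
    (fun _ t j => ⋃ k, t k ∩ {ω | r ω k j}) n
  have hs : ∀ n j, MeasurableSet (s n j) := by
    intro n
    induction n with
    | zero => intro j; by_cases h : i = j <;> simp [s, h]
    | succ n ih => exact fun j => MeasurableSet.iUnion fun k => (ih k).inter (hr k j)
  have h : {ω | Relation.ReflTransGen (r ω) i j} = ⋃ n, s n j := by
    ext ω
    simp only [mem_ofPred_eq, mem_iUnion]
    constructor
    · intro h
      induction h with
      | refl => exact ⟨0, by simp [s]⟩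
      | @tail y z _ hyz ih =>
        obtain ⟨n, hn⟩ := ih
        exact ⟨n + 1, mem_iUnion.2 ⟨y, hn, hyz⟩⟩
    · rintro ⟨n, hn⟩
      induction n generalizing j with
      | zero =>
        by_cases h : i = j
        · rw [h]
        · simp [s, h] at hn
      | succ n ih =>
        obtain ⟨k, hk, hkj⟩ := mem_iUnion.1 hn
        exact (ih k hk).tail hkj
  rw [h]
  exact MeasurableSet.iUnion fun n => hs n j

/-! ### Multiscale percolation of discs -/

/-- The length scale of level `n`. -/
noncomputable def levelScale (n : ℤ) : ℝ := (16 : ℝ) ^ (-n)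

theorem levelScale_pos (n : ℤ) : 0 < levelScale n := by unfold levelScale; positivity

theorem levelScale_succ (n : ℤ) : levelScale (n + 1) = levelScale n / 16 := by
  unfold levelScale
  rw [neg_add, zpow_add₀ (by norm_num)]
  norm_num
  ring

theorem levelScale_anti {m n : ℤ} (h : m ≤ n) : levelScale n ≤ levelScale m :=
  zpow_le_zpow_right₀ (by norm_num) (by omega)

/-- The closed disc of the cell `(k, m)`: cells of level `k` have radius `2 * 16 ^ (-k)`, and
their centers are dense. -/
noncomputable def cellDisc (i : ℤ × ℕ) : Set ℂ :=
  Metric.closedBall (denseSeq ℂ i.2) (2 * levelScale i.1)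

theorem dist_le_of_mem_cellDisc {i : ℤ × ℕ} {n : ℤ} (h : n ≤ i.1) {p q : ℂ} (hp : p ∈ cellDisc i)
    (hq : q ∈ cellDisc i) : dist p q ≤ 4 * levelScale n := by
  have h1 := levelScale_anti h
  have h2 := dist_triangle_right p q (denseSeq ℂ i.2)
  have h3 := Metric.mem_closedBall.1 hp
  have h4 := Metric.mem_closedBall.1 hq
  linarith

/-- Two cells touch if their discs intersect. -/
def Touch (i j : ℤ × ℕ) : Prop := (cellDisc i ∩ cellDisc j).Nonempty

theorem Touch.symm {i j : ℤ × ℕ} (h : Touch i j) : Touch j i := by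
  unfold Touch at *
  rwa [inter_comm]

/-- The cells of level at least `n` whose disc meets the disc of radius `2 * 16 ^ (-n)`
around `w`. -/
def nearCells (n : ℤ) (w : ℂ) : Set (ℤ × ℕ) :=
  {i | n ≤ i.1 ∧ (cellDisc i ∩ Metric.closedBall w (2 * levelScale n)).Nonempty}

/-- A chain of cells of `O`, of levels in `[n, m)`, joins the disc of radius `16 ^ (-n)` around
`w` to the outside of the disc of twice that radius. -/
def Crosses (O : Set (ℤ × ℕ)) (n m : ℤ) (w : ℂ) : Prop :=
  ∃ i j, (i ∈ O ∧ i ∈ nearCells n w ∧ i.1 < m) ∧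
    (cellDisc i ∩ Metric.closedBall w (levelScale n)).Nonempty ∧
    Relation.ReflTransGen (fun a b => Touch a b ∧ (b ∈ O ∧ b ∈ nearCells n w ∧ b.1 < m)) i j ∧
    ¬ cellDisc j ⊆ Metric.ball w (2 * levelScale n)

theorem Crosses.mono {O : Set (ℤ × ℕ)} {n m m' : ℤ} {w : ℂ} (h : Crosses O n m w) (hm : m ≤ m') :
    Crosses O n m' w := by
  obtain ⟨i, j, hi, hi2, hij, hj⟩ := h
  refine ⟨i, j, ⟨hi.1, hi.2.1, hi.2.2.trans_le hm⟩, hi2, hij.of_imp ?_, hj⟩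
  rintro a b ⟨h1, h2, h3, h4⟩
  exact ⟨h1, h2, h3, h4.trans_le hm⟩

/-- A chain that joins a disc to the outside of the disc of twice its radius can be cut so that
its cells stay near the disc. -/
theorem exists_near_chain {O : Set (ℤ × ℕ)} {w : ℂ} {r : ℝ} (hr : 0 ≤ r)
    {i j : ℤ × ℕ} (hi : i ∈ O) (hi2 : (cellDisc i ∩ Metric.closedBall w r).Nonempty)
    (hij : Relation.ReflTransGen (fun a b => Touch a b ∧ b ∈ O) i j)
    (hj : ¬ cellDisc j ⊆ Metric.ball w (2 * r)) :
    ∃ j', (i ∈ O ∧ (cellDisc i ∩ Metric.closedBall w (2 * r)).Nonempty) ∧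
      Relation.ReflTransGen (fun a b => Touch a b ∧
        (b ∈ O ∧ (cellDisc b ∩ Metric.closedBall w (2 * r)).Nonempty)) i j' ∧
      ¬ cellDisc j' ⊆ Metric.ball w (2 * r) := by
  obtain ⟨j', hj', hch⟩ := hij.exists_first (Q := fun k => cellDisc k ⊆ Metric.ball w (2 * r)) hj
  refine ⟨j', ⟨hi, hi2.mono (inter_subset_inter_right _
    (Metric.closedBall_subset_closedBall (by linarith)))⟩, hch.of_imp ?_, hj'⟩
  rintro a b ⟨hQ, hT, hb⟩
  obtain ⟨x, hxa, hxb⟩ := hT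
  exact ⟨⟨x, hxa, hxb⟩, hb, x, hxb, Metric.ball_subset_closedBall (hQ hxa)⟩

theorem crosses_of_chain {O : Set (ℤ × ℕ)} {n m : ℤ} {w : ℂ} {i j : ℤ × ℕ}
    (hi : i ∈ O ∧ n ≤ i.1 ∧ i.1 < m)
    (hi2 : (cellDisc i ∩ Metric.closedBall w (levelScale n)).Nonempty)
    (hij : Relation.ReflTransGen (fun a b => Touch a b ∧ (b ∈ O ∧ n ≤ b.1 ∧ b.1 < m)) i j)
    (hj : ¬ cellDisc j ⊆ Metric.ball w (2 * levelScale n)) : Crosses O n m w := by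
  obtain ⟨j', hi', hij', hj'⟩ := exists_near_chain (O := {b | b ∈ O ∧ n ≤ b.1 ∧ b.1 < m})
    (levelScale_pos n).le hi hi2 hij hj
  refine ⟨i, j', ⟨hi.1, ⟨hi.2.1, hi'.2⟩, hi.2.2⟩, hi2, hij'.of_imp ?_, hj'⟩
  rintro a b ⟨hT, ⟨hb1, hb2, hb3⟩, hb4⟩
  exact ⟨hT, hb1, ⟨hb2, hb4⟩, hb3⟩

/-- The mesh `1 / 16` is the ratio of consecutive scales. Radius `3` suffices because a cell of the
next level has diameter at most `r / 4` and meets the disc of radius `2 * r`. -/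
theorem exists_finset_net :
    ∃ T : Finset ℂ, Metric.closedBall (0 : ℂ) 3 ⊆ ⋃ t ∈ T, Metric.ball t (1 / 16) := by
  obtain ⟨t, -, hf, ht⟩ := Metric.finite_approx_of_totallyBounded
    (isCompact_closedBall (0 : ℂ) 3).totallyBounded (1 / 16) (by norm_num)
  exact ⟨hf.toFinset, by simpa using ht⟩

/-- A fixed finite net of the disc of radius `3`. -/
noncomputable def discNet : Finset ℂ := exists_finset_net.choose

theorem exists_mem_discNet {w p : ℂ} {r : ℝ} (hr : 0 < r) (hp : dist p w ≤ 3 * r) :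
    ∃ t ∈ discNet, dist p (w + r * t) ≤ r / 16 := by
  have h : (p - w) / r ∈ Metric.closedBall (0 : ℂ) 3 := by
    rw [mem_closedBall_zero_iff, norm_div, Complex.norm_real, Real.norm_of_nonneg hr.le,
      div_le_iff₀ hr, ← dist_eq_norm]
    exact hp
  have h2 := exists_finset_net.choose_spec h
  simp only [mem_iUnion, Metric.mem_ball, exists_prop] at h2
  obtain ⟨t, ht, hd⟩ := h2
  refine ⟨t, ht, ?_⟩
  have hr' : (r : ℂ) ≠ 0 := by exact_mod_cast hr.ne'
  have h3 : p - (w + r * t) = r * ((p - w) / r - t) := by field_simp; ring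
  rw [dist_eq_norm, h3, norm_mul, Complex.norm_real, Real.norm_of_nonneg hr.le, ← dist_eq_norm]
  nlinarith

/-- A crossing without cells of the top level contains two crossings on the next scale that are
far away from each other. -/
theorem Crosses.exists_pair {O : Set (ℤ × ℕ)} {n m : ℤ} {w : ℂ} (h : Crosses O n m w)
    (hn : ∀ i ∈ O, i.1 = n → ¬ (cellDisc i ∩ Metric.closedBall w (2 * levelScale n)).Nonempty) :
    ∃ s ∈ discNet, ∃ t ∈ discNet,
      levelScale n / 2 < dist (w + levelScale n * s) (w + levelScale n * t) ∧
      Crosses O (n + 1) m (w + levelScale n * s) ∧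
      Crosses O (n + 1) m (w + levelScale n * t) := by
  obtain ⟨i, j, hi, hi2, hij, hj⟩ := h
  have hr := levelScale_pos n
  have hs := levelScale_succ n
  have hL (b : ℤ × ℕ) (hb : b ∈ O ∧ b ∈ nearCells n w ∧ b.1 < m) :
      b ∈ O ∧ n + 1 ≤ b.1 ∧ b.1 < m := by
    -- Every cell of the chain is near `w`, so `hn` rules out level `n`.
    refine ⟨hb.1, ?_, hb.2.2⟩
    have h1 := hb.2.1.1
    have h2 : b.1 ≠ n := fun h => hn b hb.1 h hb.2.1.2
    omega
  have hij' := hij.of_imp fun a b (hab : Touch a b ∧ _) => And.intro hab.1 (hL b hab.2)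
  obtain ⟨hjL, -⟩ := hij.reverse_of_symmetric (s := Touch)
    (L := fun b => b ∈ O ∧ b ∈ nearCells n w ∧ b.1 < m) (fun _ _ => Touch.symm) hi
  obtain ⟨-, hji⟩ := hij'.reverse_of_symmetric (s := Touch)
    (L := fun b => b ∈ O ∧ n + 1 ≤ b.1 ∧ b.1 < m) (fun _ _ => Touch.symm) (hL i hi)
  obtain ⟨p, hpi, hpw⟩ := hi2
  obtain ⟨p', hpj, hpw'⟩ := Set.not_subset.1 hj
  rw [Metric.mem_closedBall] at hpw
  rw [Metric.mem_ball, not_lt] at hpw'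
  obtain ⟨x, hxj, hxw⟩ := hjL.2.1.2
  rw [Metric.mem_closedBall] at hxw
  have hx := dist_le_of_mem_cellDisc (hL j hjL).2.1 hpj hxj
  have hp3 : dist p' w ≤ 3 * levelScale n := by
    have := dist_triangle p' x w
    linarith
  obtain ⟨s, hsT, hsp⟩ := exists_mem_discNet (w := w) (p := p) hr (by linarith)
  obtain ⟨t, htT, htp⟩ := exists_mem_discNet (w := w) (p := p') hr hp3
  generalize hu : w + (levelScale n : ℂ) * s = u at *
  generalize hv : w + (levelScale n : ℂ) * t = v at *
  refine ⟨s, hsT, t, htT, ?_, ?_, ?_⟩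
  -- The ends are at distance at least `r` (`p` within `r` of `w`, `p'` at least `2 * r` away) and
  -- each net point costs `r / 16`, which leaves `7 * r / 8`.
  · rw [hu, hv]
    have h1 := dist_triangle p' v w
    have h2 := dist_triangle v u w
    have h3 := dist_triangle_left u w p
    have h4 := dist_comm u v
    have h5 := dist_comm p u
    linarith
  · rw [hu]
    refine crosses_of_chain (hL i hi) ⟨p, hpi, ?_⟩ hij' fun hsub => ?_
    · rw [Metric.mem_closedBall, hs]
      exact hsp
    · have h0 := hsub hpj
      rw [Metric.mem_ball, hs] at h0
      have h1 := dist_triangle p' u w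
      have h3 := dist_triangle_left u w p
      linarith
  -- The second crossing is the same chain, run backwards from its far end.
  · rw [hv]
    refine crosses_of_chain (hL j hjL) ⟨p', hpj, ?_⟩ hji fun hsub => ?_
    · rw [Metric.mem_closedBall, hs]
      exact htp
    · have h0 := hsub hpi
      rw [Metric.mem_ball, hs] at h0
      have h1 := dist_triangle p' v w
      have h3 := dist_triangle_left v w p
      linarith

/-- A common cell would give a distance of at most `2 + 4 + 2 = 8` units of `r / 16`, which is the
threshold `r / 2`. -/
theorem disjoint_nearCells {n : ℤ} {u v : ℂ} (h : levelScale n / 2 < dist u v) :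
    Disjoint (nearCells (n + 1) u) (nearCells (n + 1) v) := by
  rw [Set.disjoint_left]
  rintro i ⟨hi, x, hxi, hxu⟩ ⟨-, y, hyi, hyv⟩
  have h1 := dist_le_of_mem_cellDisc hi hxi hyi
  rw [Metric.mem_closedBall] at hxu hyv
  rw [levelScale_succ] at h1 hxu hyv
  have h2 := dist_triangle u x v
  have h3 := dist_triangle x y v
  have h4 := dist_comm u x
  linarith

section Percolation

variable {Ω : Type*}

/-- The information whether the cell `i` belongs to the random set `O`. -/
abbrev cellSigma (O : Ω → Set (ℤ × ℕ)) (i : ℤ × ℕ) : MeasurableSpace Ω :=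
  MeasurableSpace.comap (fun ω => i ∈ O ω) ⊤

/-- This locality is the reason why `Crosses` asks all cells of the chain to be near `w`: crossings
around distant points become independent. -/
theorem measurableSet_crosses_near (O : Ω → Set (ℤ × ℕ)) (n m : ℤ) (w : ℂ) :
    MeasurableSet[⨆ i ∈ nearCells n w, cellSigma O i] {ω | Crosses (O ω) n m w} := by
  let _ : MeasurableSpace Ω := ⨆ i ∈ nearCells n w, cellSigma O i
  have h1 (i : ℤ × ℕ) : MeasurableSet {ω | i ∈ O ω ∧ i ∈ nearCells n w ∧ i.1 < m} := by
    by_cases hi : i ∈ nearCells n w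
    · have h2 : MeasurableSet {ω | i ∈ O ω} := by
        have hle : cellSigma O i ≤ ⨆ i ∈ nearCells n w, cellSigma O i :=
          le_iSup₂_of_le i hi le_rfl
        exact hle _ ⟨{True}, trivial, by ext; simp⟩
      exact h2.inter (MeasurableSet.const (i ∈ nearCells n w ∧ i.1 < m))
    · simp [hi]
  have h3 (i j : ℤ × ℕ) := measurableSet_reflTransGen (r := fun ω a b =>
      Touch a b ∧ (b ∈ O ω ∧ b ∈ nearCells n w ∧ b.1 < m))
    (fun a b => (MeasurableSet.const (Touch a b)).inter (h1 b)) i j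
  have h4 : {ω | Crosses (O ω) n m w} = ⋃ i, ⋃ j,
      {ω | i ∈ O ω ∧ i ∈ nearCells n w ∧ i.1 < m} ∩
      ({_ω | (cellDisc i ∩ Metric.closedBall w (levelScale n)).Nonempty} ∩
      ({ω | Relation.ReflTransGen (fun a b => Touch a b ∧
        (b ∈ O ω ∧ b ∈ nearCells n w ∧ b.1 < m)) i j} ∩
      {_ω | ¬ cellDisc j ⊆ Metric.ball w (2 * levelScale n)})) := by
    ext ω
    simp [Crosses]
  rw [h4]
  exact MeasurableSet.iUnion fun i => MeasurableSet.iUnion fun j => (h1 i).inter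
    ((MeasurableSet.const _).inter ((h3 i j).inter (MeasurableSet.const _)))

variable [MeasurableSpace Ω] {P : Measure Ω} {O : Ω → Set (ℤ × ℕ)}

theorem cellSigma_le (hO : ∀ i, MeasurableSet {ω | i ∈ O ω}) (i : ℤ × ℕ) :
    cellSigma O i ≤ ‹MeasurableSpace Ω› := by
  have h : Measurable fun ω => i ∈ O ω := measurableSet_setOfPred.1 (hO i)
  exact h.comap_le

theorem measurableSet_crosses (hO : ∀ i, MeasurableSet {ω | i ∈ O ω}) (n m : ℤ) (w : ℂ) :
    MeasurableSet {ω | Crosses (O ω) n m w} :=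
  (iSup₂_le fun i _ => cellSigma_le hO i : (⨆ i ∈ nearCells n w, cellSigma O i) ≤ _) _
    (measurableSet_crosses_near O n m w)

/-- Either a cell of the top level is open nearby, or two independent crossings of the next scale
occur around some pair of net points; a union bound over the pairs gives the quadratic term. -/
theorem measure_crosses_le_succ (hO : ∀ i, MeasurableSet {ω | i ∈ O ω})
    (hind : iIndep (cellSigma O) P) (n m : ℤ) (w : ℂ) {a p : ℝ≥0∞}
    (ha : P {ω | ∃ i ∈ O ω, i.1 = n ∧
      (cellDisc i ∩ Metric.closedBall w (2 * levelScale n)).Nonempty} ≤ a)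
    (hp : ∀ u, P {ω | Crosses (O ω) (n + 1) m u} ≤ p) :
    P {ω | Crosses (O ω) n m w} ≤ a + (discNet.card : ℝ≥0∞) ^ 2 * p ^ 2 := by
  classical
  let r := levelScale n
  let F : ℂ × ℂ → Set Ω := fun q =>
    if r / 2 < dist (w + r * q.1) (w + r * q.2) then
      {ω | Crosses (O ω) (n + 1) m (w + r * q.1)} ∩ {ω | Crosses (O ω) (n + 1) m (w + r * q.2)}
    else ∅
  have hsub : {ω | Crosses (O ω) n m w} ⊆ {ω | ∃ i ∈ O ω, i.1 = n ∧
      (cellDisc i ∩ Metric.closedBall w (2 * levelScale n)).Nonempty} ∪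
      ⋃ q ∈ discNet ×ˢ discNet, F q := by
    intro ω hω
    by_cases hn : ∃ i ∈ O ω, i.1 = n ∧
        (cellDisc i ∩ Metric.closedBall w (2 * levelScale n)).Nonempty
    · exact Or.inl hn
    · push Not at hn
      obtain ⟨s, hs, t, ht, hd, h1, h2⟩ := Crosses.exists_pair hω
        (fun i hi hin => not_nonempty_iff_eq_empty.2 (hn i hi hin))
      refine Or.inr (mem_iUnion₂.2 ⟨(s, t), Finset.mem_product.2 ⟨hs, ht⟩, ?_⟩)
      simp only [F, r, if_pos hd]
      exact ⟨h1, h2⟩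
  have hF (q : ℂ × ℂ) : P (F q) ≤ p ^ 2 := by
    by_cases hd : r / 2 < dist (w + r * q.1) (w + r * q.2)
    · simp only [F, if_pos hd]
      have hi := indep_iSup_of_disjoint (cellSigma_le hO) hind (disjoint_nearCells hd)
      rw [(Indep_iff _ _ _).1 hi _ _ (measurableSet_crosses_near O _ _ _)
        (measurableSet_crosses_near O _ _ _), sq]
      exact mul_le_mul' (hp _) (hp _)
    · simp only [F, if_neg hd, measure_empty, zero_le]
  calc P {ω | Crosses (O ω) n m w}
      ≤ _ := measure_mono hsub
    _ ≤ _ + _ := measure_union_le _ _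
    _ ≤ a + ∑ q ∈ discNet ×ˢ discNet, P (F q) :=
        add_le_add ha (measure_biUnion_finset_le _ _)
    _ ≤ a + ∑ q ∈ discNet ×ˢ discNet, p ^ 2 := by gcongr; exact hF _
    _ = a + (discNet.card : ℝ≥0∞) ^ 2 * p ^ 2 := by
        simp [Finset.card_product, sq]

/-- The empty range of levels starts the induction; this is the purpose of the cutoff `m`. -/
theorem not_crosses_self (O : Set (ℤ × ℕ)) (n : ℤ) (w : ℂ) : ¬ Crosses O n n w := by
  rintro ⟨i, j, hi, -⟩
  have := hi.2.1.1
  have := hi.2.2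
  omega

/-- If discs of each scale are rare, crossings are rare on all scales. -/
theorem measure_crosses_le (hO : ∀ i, MeasurableSet {ω | i ∈ O ω})
    (hind : iIndep (cellSigma O) P) {a : ℝ≥0∞}
    (ha : ∀ n w, P {ω | ∃ i ∈ O ω, i.1 = n ∧
      (cellDisc i ∩ Metric.closedBall w (2 * levelScale n)).Nonempty} ≤ a)
    (hK : (discNet.card : ℝ≥0∞) ^ 2 * (2 * a) ^ 2 ≤ a) (k : ℕ) (n : ℤ) (w : ℂ) :
    P {ω | Crosses (O ω) n (n + k) w} ≤ 2 * a := by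
  induction k generalizing n w with
  | zero => simp [not_crosses_self]
  | succ k ih =>
    have h := measure_crosses_le_succ hO hind n (n + (k + 1 : ℕ)) w (ha n w) (p := 2 * a) (by
      intro u
      have := ih (n + 1) u
      rwa [show n + 1 + (k : ℤ) = n + (k + 1 : ℕ) by push_cast; ring] at this)
    refine h.trans ?_
    rw [two_mul a]
    gcongr
    rwa [← two_mul]

/-- If moreover there are no discs of negative level, crossings decay fast on large scales. -/
theorem measure_crosses_neg_le (hO : ∀ i, MeasurableSet {ω | i ∈ O ω})
    (hind : iIndep (cellSigma O) P) (hneg : ∀ ω, ∀ i ∈ O ω, 0 ≤ i.1) {a ρ : ℝ≥0∞} (hρ : ρ ≤ 1)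
    (ha : ∀ n w, P {ω | ∃ i ∈ O ω, i.1 = n ∧
      (cellDisc i ∩ Metric.closedBall w (2 * levelScale n)).Nonempty} ≤ a)
    (hK : (discNet.card : ℝ≥0∞) ^ 2 * (2 * a) ^ 2 ≤ a)
    (hKρ : (discNet.card : ℝ≥0∞) ^ 2 * (2 * a) ≤ ρ) (j k : ℕ) (w : ℂ) :
    P {ω | Crosses (O ω) (-(j : ℤ)) k w} ≤ 2 * a * ρ ^ j := by
  induction j generalizing w with
  | zero => simpa using measure_crosses_le hO hind ha hK k 0 w
  | succ j ih =>
    have h := measure_crosses_le_succ hO hind (-((j + 1 : ℕ) : ℤ)) k w (a := 0)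
      (p := 2 * a * ρ ^ j) (by
        have : {ω | ∃ i ∈ O ω, i.1 = -((j + 1 : ℕ) : ℤ) ∧ (cellDisc i ∩
            Metric.closedBall w (2 * levelScale (-((j + 1 : ℕ) : ℤ)))).Nonempty} = ∅ := by
          ext ω
          simp only [mem_ofPred_eq, mem_empty_iff_false, iff_false]
          rintro ⟨i, hi, hi2, -⟩
          have := hneg ω i hi
          omega
        rw [this, measure_empty]) (by
        intro u
        have := ih u
        rwa [show (-(j : ℤ)) = -((j + 1 : ℕ) : ℤ) + 1 by push_cast; ring] at this)
    refine h.trans ?_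
    rw [zero_add]
    -- One of the two crossing factors, with the net constant, pays for the extra `ρ`; its own `ρ ^
    -- j` is discarded.
    calc (discNet.card : ℝ≥0∞) ^ 2 * (2 * a * ρ ^ j) ^ 2
        = ((discNet.card : ℝ≥0∞) ^ 2 * (2 * a)) * (2 * a * ρ ^ j) * ρ ^ j := by ring
      _ ≤ ρ * (2 * a * ρ ^ j) * 1 := by
        gcongr
        exact pow_le_one₀ zero_le hρ
      _ = 2 * a * ρ ^ (j + 1) := by ring

end Percolation

/-! ### The intensity measure -/

/-- The measure `dρ / ρ` on the positive half-line. -/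
noncomputable abbrev logScaleMeasure : Measure ℝ :=
  ((volume : Measure ℝ).restrict (Ioi 0)).withDensity (fun ρ => ENNReal.ofReal ρ⁻¹)

theorem ae_logScaleMeasure_pos : ∀ᵐ ρ ∂logScaleMeasure, 0 < ρ :=
  (withDensity_absolutelyContinuous _ _).ae_le (ae_restrict_mem measurableSet_Ioi)

theorem logScaleMeasure_Ico_le {a b : ℝ} (ha : 0 < a) :
    logScaleMeasure (Ico a b) ≤ ENNReal.ofReal ((b - a) / a) := by
  rw [withDensity_apply _ measurableSet_Ico]
  calc ∫⁻ ρ in Ico a b, ENNReal.ofReal ρ⁻¹ ∂(volume.restrict (Ioi 0))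
      ≤ ∫⁻ _ in Ico a b, ENNReal.ofReal a⁻¹ ∂(volume.restrict (Ioi 0)) := by
        refine setLIntegral_mono measurable_const fun ρ hρ => ?_
        exact ENNReal.ofReal_le_ofReal (inv_anti₀ ha hρ.1)
    _ = ENNReal.ofReal a⁻¹ * (volume.restrict (Ioi 0)) (Ico a b) := by simp
    _ ≤ ENNReal.ofReal a⁻¹ * volume (Ico a b) := by gcongr; exact Measure.restrict_le_self
    _ = ENNReal.ofReal ((b - a) / a) := by
        rw [Real.volume_Ico, ← ENNReal.ofReal_mul (by positivity), div_eq_inv_mul]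

theorem coe_translateScale (z : ℂ) (ρ : ℝ) (γ : PlanarCompact) :
    (translateScale z ρ γ : Set ℂ) = (fun w : ℂ => (ρ : ℂ) * (z + w)) '' γ := rfl

open scoped Pointwise in
theorem diam_translateScale (z : ℂ) {ρ : ℝ} (hρ : 0 < ρ) (γ : PlanarCompact) :
    Metric.diam (translateScale z ρ γ : Set ℂ) = ρ * Metric.diam (γ : Set ℂ) := by
  have h : (translateScale z ρ γ : Set ℂ) = ρ • (z +ᵥ (γ : Set ℂ)) := by
    rw [coe_translateScale, ← Set.image_vadd, ← Set.image_smul, Set.image_image]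
    simp [mul_add]
  rw [h, diam_smul₀, diam_vadd, Real.norm_of_nonneg hρ.le]

theorem norm_le_two_of_mem_square {w : ℂ} (hw : w ∈ Icc (-1 : ℝ) 1 ×ℂ Icc (-1 : ℝ) 1) :
    ‖w‖ ≤ 2 := by
  rw [Complex.mem_reProdIm] at hw
  have h1 := abs_le.2 hw.1
  have h2 := abs_le.2 hw.2
  linarith [Complex.norm_le_abs_re_add_abs_im w]

section Intensity

variable {π : Measure PlanarCompact}

theorem ae_shape [SFinite π] (hπ : IsShapeMeasure π) : ∀ᵐ p ∂(logScaleMeasure.prod π),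
    0 < p.1 ∧ Metric.diam (p.2 : Set ℂ) = 1 ∧ ∀ w ∈ (p.2 : Set ℂ), ‖w‖ ≤ 2 := by
  have h1 := Measure.quasiMeasurePreserving_fst.ae (μa := logScaleMeasure.prod π)
    ae_logScaleMeasure_pos
  have h2 := Measure.quasiMeasurePreserving_snd.ae (μa := logScaleMeasure.prod π) hπ
  filter_upwards [h1, h2] with p hp1 hp2
  exact ⟨hp1, hp2.2.1, fun w hw => norm_le_two_of_mem_square (hp2.2.2 hw)⟩

theorem soupMeasure_apply [SFinite π] {A : Set PlanarCompact} (hA : MeasurableSet A) :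
    soupMeasure π A = ∫⁻ p, volume {z | translateScale z p.1 p.2 ∈ A} ∂(logScaleMeasure.prod π) := by
  rw [soupMeasure, Measure.map_apply measurable_translateScale hA,
    Measure.prod_apply_symm (measurable_translateScale hA)]
  rfl

/-- The compact sets of diameter in `[a, b)` that meet the closed disc of radius `s` at `w`. -/
def meetingLoops (a b : ℝ) (w : ℂ) (s : ℝ) : Set PlanarCompact :=
  {γ | Metric.diam (γ : Set ℂ) ∈ Ico a b ∧ ((γ : Set ℂ) ∩ Metric.closedBall w s).Nonempty}

theorem measurableSet_meetingLoops (a b : ℝ) (w : ℂ) (s : ℝ) :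
    MeasurableSet (meetingLoops a b w s) :=
  (measurable_diam measurableSet_Ico).inter
    (NonemptyCompacts.isClosed_inter_nonempty_of_isClosed Metric.isClosed_closedBall).measurableSet

/-- At scale `ρ ∈ [a, b)` the translation `z` has to lie within `s / ρ + 2` of `w / ρ`, because
shapes lie in the disc of radius `2`; the area of such `z` is bounded uniformly. -/
theorem soupMeasure_meetingLoops_le [SFinite π] (hπ : IsShapeMeasure π) {a b : ℝ} (ha : 0 < a) (w : ℂ) {s : ℝ}
    (hs : 0 ≤ s) :
    soupMeasure π (meetingLoops a b w s) ≤
      volume (Metric.closedBall (0 : ℂ) (s / a + 2)) * (ENNReal.ofReal ((b - a) / a) * π univ) := by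
  rw [soupMeasure_apply (measurableSet_meetingLoops a b w s)]
  calc _ ≤ ∫⁻ p, (Ico a b ×ˢ univ).indicator
        (fun _ => volume (Metric.closedBall (0 : ℂ) (s / a + 2))) p ∂(logScaleMeasure.prod π) := by
        refine lintegral_mono_ae ?_
        filter_upwards [ae_shape hπ] with p ⟨hp0, hp1, hp2⟩
        by_cases hp : p.1 ∈ Ico a b
        · rw [indicator_of_mem (by simpa using hp)]
          rw [← Measure.addHaar_closedBall_center volume (w / p.1)]
          refine measure_mono fun z hz => ?_
          obtain ⟨-, _, ⟨y, hy, rfl⟩, hyw⟩ := hz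
          have hp0' : (p.1 : ℂ) ≠ 0 := by exact_mod_cast hp0.ne'
          have h1 : dist (z + y) (w / p.1) ≤ s / a := by
            have h2 : (p.1 : ℂ) * (z + y) - w = p.1 * (z + y - w / p.1) := by field_simp
            rw [Metric.mem_closedBall, dist_eq_norm, h2, norm_mul, Complex.norm_real,
              Real.norm_of_nonneg hp0.le, mul_comm, ← le_div_iff₀ hp0] at hyw
            rw [dist_eq_norm]
            exact hyw.trans (div_le_div_of_nonneg_left hs ha hp.1)
          have h3 : dist z (z + y) ≤ 2 := by simpa using hp2 y hy
          rw [Metric.mem_closedBall]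
          linarith [dist_triangle z (z + y) (w / p.1)]
        · have : {z | translateScale z p.1 p.2 ∈ meetingLoops a b w s} = ∅ := by
            refine eq_empty_of_forall_notMem fun z hz => hp ?_
            have := hz.1
            rwa [diam_translateScale z hp0, hp1, mul_one] at this
          rw [this, measure_empty]
          exact zero_le
    _ = volume (Metric.closedBall (0 : ℂ) (s / a + 2)) * (logScaleMeasure (Ico a b) * π univ) := by
        rw [lintegral_indicator_const (measurableSet_Ico.prod MeasurableSet.univ),
          Measure.prod_prod]
    _ ≤ _ := by gcongr; exact logScaleMeasure_Ico_le ha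

/-- A set of diameter `0` has no level, so it has to be excluded before loops are assigned to cells.
-/
theorem soupMeasure_diam_zero [SFinite π] (hπ : IsShapeMeasure π) :
    soupMeasure π {γ | Metric.diam (γ : Set ℂ) = 0} = 0 := by
  have hm : MeasurableSet {γ : PlanarCompact | Metric.diam (γ : Set ℂ) = 0} :=
    measurable_diam (measurableSet_singleton 0)
  rw [soupMeasure_apply hm, lintegral_eq_zero_iff']
  · filter_upwards [ae_shape hπ] with p ⟨hp0, hp1, _⟩
    have : {z | translateScale z p.1 p.2 ∈ {γ : PlanarCompact | Metric.diam (γ : Set ℂ) = 0}} = ∅ := by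
      refine eq_empty_of_forall_notMem fun z hz => hp0.ne' ?_
      rwa [mem_ofPred_eq, mem_ofPred_eq, diam_translateScale z hp0, hp1, mul_one] at hz
    exact (congrArg volume this).trans measure_empty
  · exact (measurable_measure_prodMk_right
      (measurable_translateScale hm)).aemeasurable

/-- A bound, for all levels, of the mass of the loops of that level near a given point. -/
noncomputable def levelMass (π : Measure PlanarCompact) : ℝ≥0∞ :=
  volume (Metric.closedBall (0 : ℂ) 98) * (ENNReal.ofReal 15 * π univ)

theorem levelMass_lt_top [IsFiniteMeasure π] : levelMass π < ∞ :=
  ENNReal.mul_lt_top measure_closedBall_lt_top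
    (ENNReal.mul_lt_top ENNReal.ofReal_lt_top (measure_lt_top _ _))

/-- Scale invariance: only ratios of lengths enter, which gives `98 = 6 * 16 + 2` and `15 = 16 - 1`
at every level. The radius `6` is the `2` of a nearby disc plus the diameter `4` of a cell. -/
theorem soupMeasure_level_le [SFinite π] (hπ : IsShapeMeasure π) (n : ℤ) (w : ℂ) :
    soupMeasure π (meetingLoops (levelScale (n + 1)) (levelScale n) w (6 * levelScale n)) ≤
      levelMass π := by
  have hr := levelScale_pos n
  have h := soupMeasure_meetingLoops_le hπ (b := levelScale n) (levelScale_pos (n + 1)) w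
    (s := 6 * levelScale n) (by positivity)
  rw [levelScale_succ] at h ⊢
  rw [show 6 * levelScale n / (levelScale n / 16) + 2 = 98 by field_simp; norm_num,
    show (levelScale n - levelScale n / 16) / (levelScale n / 16) = 15 by field_simp; norm_num] at h
  exact h

end Intensity

/-! ### Poisson soups -/

section Soup

variable {Ω : Type*} {J : Ω → Set ℕ} {X : ℕ → Ω → PlanarCompact}

theorem soupCount_ne_zero_iff {A : Set PlanarCompact} {ω : Ω} :
    soupCount J X A ω ≠ 0 ↔ ∃ j ∈ J ω, X j ω ∈ A := by
  rw [soupCount, Set.encard_ne_zero]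
  rfl

variable [MeasurableSpace Ω] {P : Measure Ω} {ν : Measure PlanarCompact}

theorem poissonMeasure_ne_zero_le (r : ℝ≥0) : poissonMeasure r {0}ᶜ ≤ r := by
  rw [prob_compl_eq_one_sub (measurableSet_singleton 0), poissonMeasure_singleton]
  simp only [pow_zero, mul_one, Nat.factorial_zero, Nat.cast_one, div_one]
  rw [← ENNReal.ofReal_one, ← ENNReal.ofReal_sub _ (Real.exp_pos _).le,
    ← ENNReal.ofReal_coe_nnreal]
  refine ENNReal.ofReal_le_ofReal ?_
  linarith [Real.add_one_le_exp (-(r : ℝ))]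

theorem IsPoissonSoup.measurableSet_exists (h : IsPoissonSoup P ν J X) {A : Set PlanarCompact}
    (hA : MeasurableSet A) : MeasurableSet {ω | ∃ j ∈ J ω, X j ω ∈ A} := by
  have : {ω | ∃ j ∈ J ω, X j ω ∈ A} = ⋃ j, {ω | j ∈ J ω} ∩ X j ⁻¹' A := by ext; simp
  rw [this]
  exact MeasurableSet.iUnion fun j => (h.measurableSet_index j).inter (h.measurable_curve j hA)

theorem IsPoissonSoup.measure_exists_le (h : IsPoissonSoup P ν J X) {A : Set PlanarCompact}
    (hA : MeasurableSet A) : P {ω | ∃ j ∈ J ω, X j ω ∈ A} ≤ ν A := by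
  by_cases hν : ν A = ∞
  · simp [hν]
  have hlaw := h.law_of_finite A hA hν
  have hmeas : AEMeasurable (soupCount J X A) P := by
    -- The push-forward by a map that is not a.e. measurable is `0` by convention; here it is a
    -- Poisson law, so the count is a.e. measurable.
    refine aemeasurable_of_map_neZero ?_
    rw [hlaw]
    infer_instance
  have heq : {ω | ∃ j ∈ J ω, X j ω ∈ A} = soupCount J X A ⁻¹' {0}ᶜ := by
    ext ω
    simp only [mem_ofPred_eq, mem_preimage, mem_compl_iff, mem_singleton_iff]
    exact soupCount_ne_zero_iff.symm
  rw [heq, ← Measure.map_apply_of_aemeasurable hmeas (MeasurableSet.of_discrete), hlaw,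
    Measure.map_apply (measurable_of_countable _) (MeasurableSet.of_discrete)]
  have : (fun n : ℕ => (n : ℕ∞)) ⁻¹' {0}ᶜ = {0}ᶜ := by ext; simp
  rw [this]
  refine (poissonMeasure_ne_zero_le _).trans ?_
  rw [ENNReal.coe_toNNReal hν]

theorem IsPoissonSoup.iIndepFun_soupCount (h : IsPoissonSoup P ν J X) {ι : Type*}
    {A : ι → Set PlanarCompact} (hA : ∀ i, MeasurableSet (A i))
    (hd : Pairwise (fun i j => Disjoint (A i) (A j))) :
    iIndepFun (fun i => soupCount J X (A i)) P := by
  rw [iIndepFun_iff_finset]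
  intro s
  have e := s.equivFin
  have h2 := h.indep s.card (fun k => A (e.symm k)) (fun k => hA _)
    (fun k l hkl => hd fun heq => hkl (e.symm.injective (Subtype.ext heq)))
  have h3 := h2.precomp e.injective
  simpa [Finset.restrict_def] using h3

/-- The compact sets that are assigned to the cell `i = (k, m)`: their diameter is of order
`16 ^ (-k)` and `m` is the first index such that they are contained in `cellDisc (k, m)`. -/
noncomputable def cellLoops (i : ℤ × ℕ) : Set PlanarCompact :=
  disjointed (fun m => {γ : PlanarCompact | (γ : Set ℂ) ⊆ cellDisc (i.1, m)}) i.2 ∩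
    {γ | Metric.diam (γ : Set ℂ) ∈ Ico (levelScale (i.1 + 1)) (levelScale i.1)}

theorem measurableSet_cellLoops (i : ℤ × ℕ) : MeasurableSet (cellLoops i) := by
  refine MeasurableSet.inter (MeasurableSet.disjointed (fun m => ?_) _)
    (measurable_diam measurableSet_Ico)
  exact (NonemptyCompacts.isClosed_subsets_of_isClosed Metric.isClosed_closedBall).measurableSet

theorem exists_level {d : ℝ} (hd : 0 < d) :
    ∃ k : ℤ, d ∈ Ico (levelScale (k + 1)) (levelScale k) := by
  obtain ⟨n, hn1, hn2⟩ := exists_mem_Ico_zpow hd (y := (16 : ℝ)) (by norm_num)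
  refine ⟨-n - 1, ?_, ?_⟩
  · simpa [levelScale] using hn1
  · simpa [levelScale, add_comm] using hn2

theorem level_unique {d : ℝ} {k l : ℤ} (hk : d ∈ Ico (levelScale (k + 1)) (levelScale k))
    (hl : d ∈ Ico (levelScale (l + 1)) (levelScale l)) : k = l := by
  by_contra hne
  rcases lt_or_gt_of_ne hne with h | h
  · have := levelScale_anti (show k + 1 ≤ l by omega)
    linarith [hk.1, hl.2]
  · have := levelScale_anti (show l + 1 ≤ k by omega)
    linarith [hl.1, hk.2]

theorem pairwise_disjoint_cellLoops :
    Pairwise (fun i j => Disjoint (cellLoops i) (cellLoops j)) := by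
  rintro ⟨k, m⟩ ⟨l, n⟩ hne
  rw [Set.disjoint_left]
  rintro γ ⟨h1, h2⟩ ⟨h3, h4⟩
  obtain rfl : k = l := level_unique h2 h4
  exact Set.disjoint_left.1 (disjoint_disjointed _ fun h => hne (by simpa using h)) h1 h3

theorem exists_mem_cellLoops {γ : PlanarCompact} (hγ : 0 < Metric.diam (γ : Set ℂ)) :
    ∃ i, γ ∈ cellLoops i := by
  obtain ⟨k, hk⟩ := exists_level hγ
  obtain ⟨p, hp⟩ := γ.nonempty
  -- A center within `16^(-k)` of a point of the loop, plus a diameter below `16^(-k)`, accounts for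
  -- the disc radius `2 * 16^(-k)`.
  obtain ⟨m, hm⟩ : ∃ m, dist p (denseSeq ℂ m) < levelScale k := by
    obtain ⟨m, hm⟩ := (denseRange_denseSeq ℂ).exists_dist_lt p (levelScale_pos k)
    exact ⟨m, hm⟩
  have h : γ ∈ ⋃ m, {γ : PlanarCompact | (γ : Set ℂ) ⊆ cellDisc (k, m)} := by
    refine mem_iUnion.2 ⟨m, fun q hq => ?_⟩
    have h1 := Metric.dist_le_diam_of_mem γ.isCompact.isBounded hq hp
    have h2 := dist_triangle q p (denseSeq ℂ m)
    rw [cellDisc, Metric.mem_closedBall]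
    linarith [hk.2]
  rw [← iUnion_disjointed] at h
  obtain ⟨n, hn⟩ := mem_iUnion.1 h
  exact ⟨(k, n), hn, hk⟩

theorem subset_cellDisc {i : ℤ × ℕ} {γ : PlanarCompact} (h : γ ∈ cellLoops i) :
    (γ : Set ℂ) ⊆ cellDisc i :=
  disjointed_subset _ _ h.1

/-- The cells of nonnegative level that contain a loop of the soup. -/
def openCells (J : Ω → Set ℕ) (X : ℕ → Ω → PlanarCompact) (ω : Ω) : Set (ℤ × ℕ) :=
  {i | 0 ≤ i.1 ∧ ∃ j ∈ J ω, X j ω ∈ cellLoops i}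

theorem IsPoissonSoup.measurableSet_mem_openCells (h : IsPoissonSoup P ν J X) (i : ℤ × ℕ) :
    MeasurableSet {ω | i ∈ openCells J X ω} :=
  (MeasurableSet.const (0 ≤ i.1)).inter (h.measurableSet_exists (measurableSet_cellLoops i))

/-- Counts of a Poisson process in disjoint sets are independent, and openness of a cell is a
function of its count. -/
theorem IsPoissonSoup.iIndep_openCells (h : IsPoissonSoup P ν J X) :
    iIndep (cellSigma (openCells J X)) P := by
  have h1 := h.iIndepFun_soupCount measurableSet_cellLoops pairwise_disjoint_cellLoops
  have h2 := h1.comp (γ := fun _ => Prop) (fun i n => 0 ≤ i.1 ∧ n ≠ 0)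
    (fun i => measurable_of_countable _)
  have h3 : (fun i ω => i ∈ openCells J X ω) =
      fun i => (fun n : ℕ∞ => 0 ≤ i.1 ∧ n ≠ 0) ∘ soupCount J X (cellLoops i) := by
    funext i ω
    simp only [Function.comp, soupCount_ne_zero_iff]
    rfl
  rw [← h3] at h2
  exact h2

theorem IsPoissonSoup.measure_openCells_le (h : IsPoissonSoup P ν J X) {a : ℝ≥0∞}
    (ha : ∀ n w, ν (meetingLoops (levelScale (n + 1)) (levelScale n) w (6 * levelScale n)) ≤ a)
    (n : ℤ) (w : ℂ) :
    P {ω | ∃ i ∈ openCells J X ω, i.1 = n ∧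
      (cellDisc i ∩ Metric.closedBall w (2 * levelScale n)).Nonempty} ≤ a := by
  refine le_trans (measure_mono ?_)
    ((h.measure_exists_le (measurableSet_meetingLoops _ _ w (6 * levelScale n))).trans (ha n w))
  rintro ω ⟨i, ⟨-, j, hj, hji⟩, rfl, x, hxi, hxw⟩
  refine ⟨j, hj, hji.2, ?_⟩
  obtain ⟨p, hp⟩ := (X j ω).nonempty
  refine ⟨p, hp, ?_⟩
  have h1 := dist_le_of_mem_cellDisc le_rfl (subset_cellDisc hji hp) hxi
  rw [Metric.mem_closedBall] at hxw ⊢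
  linarith [dist_triangle p x w]

end Soup

/-! ### From clusters of loops to crossings of discs -/

theorem levelScale_zero : levelScale 0 = 1 := by simp [levelScale]

theorem levelScale_neg (j : ℕ) : levelScale (-(j : ℤ)) = 16 ^ j := by simp [levelScale]

/-- A chain of open cells, of arbitrarily small scales, crosses an annulus at scale `16 ^ (-n)`. -/
def CrossesAll (O : Set (ℤ × ℕ)) (n : ℤ) (w : ℂ) : Prop := ∃ m : ℕ, Crosses O n m w

/-- A finite chain involves finitely many levels, so the truncated crossing events exhaust the
untruncated one. -/
theorem exists_level_bound {O : Set (ℤ × ℕ)} {i j : ℤ × ℕ}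
    (h : Relation.ReflTransGen (fun a b => Touch a b ∧ b ∈ O) i j) :
    ∃ m : ℕ, i.1 < m ∧
      Relation.ReflTransGen (fun a b => Touch a b ∧ (b ∈ O ∧ b.1 < (m : ℤ))) i j := by
  induction h with
  | refl => exact ⟨(i.1 + 1).toNat, by omega, .refl⟩
  | @tail y z _ hyz ih =>
    obtain ⟨m, hm, hc⟩ := ih
    refine ⟨max m (z.1 + 1).toNat, by omega, (hc.of_imp ?_).tail ⟨hyz.1, hyz.2, by omega⟩⟩
    rintro a b ⟨h1, h2, h3⟩
    exact ⟨h1, h2, by omega⟩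

section Cluster

variable {Ω : Type*} {J : Ω → Set ℕ} {X : ℕ → Ω → PlanarCompact} {ω : Ω}

theorem exists_openCell (hpos : ∀ j ∈ J ω, 0 < Metric.diam (X j ω : Set ℂ)) {γ : PlanarCompact}
    (hγ : γ ∈ smallLoops J X ω) : ∃ i ∈ openCells J X ω, γ ∈ cellLoops i := by
  obtain ⟨⟨j, hj, rfl⟩, hd⟩ := hγ
  obtain ⟨i, hi⟩ := exists_mem_cellLoops (hpos j hj)
  refine ⟨i, ⟨?_, j, hj, hi⟩, hi⟩
  by_contra hneg
  have h1 := levelScale_anti (show i.1 + 1 ≤ 0 by omega)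
  rw [levelScale_zero] at h1
  linarith [hi.2.1]

theorem exists_cell_chain (hpos : ∀ j ∈ J ω, 0 < Metric.diam (X j ω : Set ℂ))
    {γ γ' : PlanarCompact} {i : ℤ × ℕ} (hi : γ ∈ cellLoops i)
    (h : Relation.ReflTransGen (fun a b => b ∈ smallLoops J X ω ∧ Linked a b) γ γ') :
    ∃ j, γ' ∈ cellLoops j ∧
      Relation.ReflTransGen (fun a b => Touch a b ∧ b ∈ openCells J X ω) i j := by
  induction h with
  | refl => exact ⟨i, hi, .refl⟩
  | @tail y z _ hyz ih =>
    obtain ⟨k, hk, hc⟩ := ih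
    obtain ⟨l, hl, hzl⟩ := exists_openCell hpos hyz.1
    obtain ⟨x, hxy, hxz⟩ := hyz.2.1
    exact ⟨l, hzl, hc.tail ⟨⟨x, subset_cellDisc hk hxy, subset_cellDisc hzl hxz⟩, hl⟩⟩

/-- Linked loops meet, so their cells touch. The chain of cells is cut before it leaves the doubled
disc, so `hn` only needs to exclude coarse open cells near `w`. -/
theorem crossesAll_of_chain (hpos : ∀ j ∈ J ω, 0 < Metric.diam (X j ω : Set ℂ)) {n : ℤ} {w : ℂ}
    (hn : ∀ i ∈ openCells J X ω,
      (cellDisc i ∩ Metric.closedBall w (2 * levelScale n)).Nonempty → n ≤ i.1)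
    {γ γ' : PlanarCompact} (hγ : γ ∈ smallLoops J X ω)
    (hγw : ((γ : Set ℂ) ∩ Metric.closedBall w (levelScale n)).Nonempty)
    (h : Relation.ReflTransGen (fun a b => b ∈ smallLoops J X ω ∧ Linked a b) γ γ')
    (hγ' : ¬ (γ' : Set ℂ) ⊆ Metric.ball w (2 * levelScale n)) :
    CrossesAll (openCells J X ω) n w := by
  obtain ⟨i, hi, hγi⟩ := exists_openCell hpos hγ
  obtain ⟨j, hj, hc⟩ := exists_cell_chain hpos hγi h
  have hi2 := hγw.mono (inter_subset_inter_left _ (subset_cellDisc hγi))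
  obtain ⟨j', hi', hc', hj'⟩ := exists_near_chain (levelScale_pos n).le hi hi2 hc
    fun hsub => hγ' ((subset_cellDisc hj).trans hsub)
  obtain ⟨m, hm, hc''⟩ := exists_level_bound (O := {b | b ∈ openCells J X ω ∧
    (cellDisc b ∩ Metric.closedBall w (2 * levelScale n)).Nonempty}) hc'
  refine ⟨m, crosses_of_chain ⟨hi, hn i hi hi'.2, hm⟩ hi2 (hc''.of_imp ?_) hj'⟩
  rintro a b ⟨h1, ⟨h2, h3⟩, h4⟩
  exact ⟨h1, h2, hn b h2 h3, h4⟩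

/-- Keep the part of the chain after its last visit to `γ`. The marked loop need not belong to any
open cell, so it must be removed before passing to cells. -/
theorem chain_insert {S : Set PlanarCompact} {γ γ' : PlanarCompact}
    (h : Relation.ReflTransGen (fun a b => b ∈ insert γ S ∧ Linked a b) γ γ') :
    γ' = γ ∨ ∃ γ₁ ∈ S, Linked γ γ₁ ∧
      Relation.ReflTransGen (fun a b => b ∈ S ∧ Linked a b) γ₁ γ' := by
  induction h with
  | refl => exact Or.inl rfl
  | @tail y z _ hyz ih =>
    rcases hyz.1 with hz | hz
    · exact Or.inl hz
    · right
      rcases ih with rfl | ⟨γ₁, h1, h2, h3⟩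
      · exact ⟨z, hz, hyz.2, .refl⟩
      · exact ⟨γ₁, h1, h2, h3.tail ⟨hz, hyz.2⟩⟩

theorem Linked.symm {γ γ' : PlanarCompact} (h : Linked γ γ') : Linked γ' γ := by
  unfold Linked at *
  rwa [inter_comm, inter_comm (loopInterior (γ' : Set ℂ))]

/-- Without crossing at scale `16 ^ j`, the cluster is contained in a disc of that order. -/
theorem clusterOf_subset_ball (hpos : ∀ j ∈ J ω, 0 < Metric.diam (X j ω : Set ℂ)) {j : ℕ}
    (hj : ¬ CrossesAll (openCells J X ω) (-(j : ℤ)) 0) {γ : PlanarCompact}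
    (hγ : (γ : Set ℂ) ⊆ Metric.closedBall 0 (16 ^ j)) :
    clusterOf (insert γ (smallLoops J X ω)) γ ⊆ Metric.ball 0 (2 * 16 ^ j) := by
  refine iUnion₂_subset fun γ' hγ' => ?_
  rcases chain_insert hγ' with rfl | ⟨γ₁, h1, h2, h3⟩
  · exact hγ.trans (Metric.closedBall_subset_ball (by
      linarith [pow_pos (show (0 : ℝ) < 16 by norm_num) j]))
  · by_contra hsub
    obtain ⟨x, hx, hx1⟩ := h2.1
    rw [← levelScale_neg] at hsub hγ
    exact hj (crossesAll_of_chain hpos (fun i hi _ => by have := hi.1; omega) h1 ⟨x, hx1, hγ hx⟩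
      h3 hsub)

/-- Without crossing at scale `16 ^ (-n)` near `γ` and without loops larger than that scale, the
cluster of `γ` stays close to `γ`. -/
theorem clusterOf_subset_cthickening (hpos : ∀ j ∈ J ω, 0 < Metric.diam (X j ω : Set ℂ)) {n : ℕ}
    {T : Set ℂ} (hT2 : T ⊆ Metric.closedBall 0 2)
    (hT : Metric.closedBall (0 : ℂ) 2 ⊆ ⋃ t ∈ T, Metric.ball t (levelScale n))
    (hcr : ∀ t ∈ T, ¬ CrossesAll (openCells J X ω) n t)
    (hbig : ¬ ∃ j ∈ J ω, X j ω ∈ meetingLoops (levelScale n) 1 0 10) {γ : PlanarCompact}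
    (hγ : (γ : Set ℂ) ⊆ Metric.closedBall 0 2) :
    clusterOf (insert γ (smallLoops J X ω)) γ ⊆ Metric.cthickening (3 * levelScale n) γ := by
  have hr1 : levelScale n ≤ 1 := by
    rw [← levelScale_zero]
    exact levelScale_anti (by omega)
  refine iUnion₂_subset fun γ' hγ' => ?_
  rcases chain_insert hγ' with rfl | ⟨γ₁, h1, h2, h3⟩
  · exact Metric.self_subset_cthickening _
  · obtain ⟨x, hx, hx1⟩ := h2.1
    have hx2 := hT (hγ hx)
    simp only [mem_iUnion, exists_prop] at hx2
    obtain ⟨t, ht, hxt⟩ := hx2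
    have hsub : (γ' : Set ℂ) ⊆ Metric.ball t (2 * levelScale n) := by
      by_contra hsub
      refine hcr t ht (crossesAll_of_chain hpos ?_ h1 ⟨x, hx1, Metric.ball_subset_closedBall hxt⟩
        h3 hsub)
      rintro i ⟨hi0, j, hj, hji⟩ ⟨y, hyi, hyt⟩
      by_contra hlt
      -- An open cell of level below `n` contains a loop of diameter in `[16^(-n), 1)`, within `4 +
      -- 2 + 2 ≤ 10` of the origin.
      refine hbig ⟨j, hj, ⟨(levelScale_anti (by omega)).trans hji.2.1, ?_⟩, ?_⟩
      · rw [← levelScale_zero]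
        exact hji.2.2.trans_le (levelScale_anti hi0)
      · obtain ⟨q, hq⟩ := (X j ω).nonempty
        refine ⟨q, hq, ?_⟩
        have h4 := dist_le_of_mem_cellDisc hi0 (subset_cellDisc hji hq) hyi
        have h5 := hT2 ht
        rw [Metric.mem_closedBall] at h5 hyt ⊢
        rw [levelScale_zero] at h4
        linarith [dist_triangle q y 0, dist_triangle y t 0]
    intro q hq
    refine Metric.mem_cthickening_of_dist_le q x _ _ hx ?_
    have h6 := Metric.mem_ball.1 (hsub hq)
    have h7 := Metric.mem_ball.1 hxt
    linarith [dist_triangle_right q x t]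

theorem crossesAll_of_hasCrossingCluster (hpos : ∀ j ∈ J ω, 0 < Metric.diam (X j ω : Set ℂ))
    {j : ℕ} (hj : 1 ≤ j) {x : ℝ} (hx : 2 * 16 ^ j ≤ x)
    (h : HasCrossingCluster (smallLoops J X ω) 4 x) :
    CrossesAll (openCells J X ω) (-(j : ℤ)) 0 := by
  obtain ⟨γ, hγ, ⟨p, hp, hp4⟩, ⟨q, hq, hqx⟩⟩ := h
  simp only [clusterOf, mem_iUnion, mem_ofPred_eq, exists_prop] at hp hq
  obtain ⟨γ₁, h1, hp1⟩ := hp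
  obtain ⟨γ₂, h2, hq2⟩ := hq
  -- Reverse the chain to the inner circle and append the chain to the outer one; the base loop of
  -- the cluster may lie anywhere.
  obtain ⟨hγ₁, h3⟩ := (h1.of_imp (p := fun a b => Linked a b ∧ b ∈ smallLoops J X ω)
    fun _ _ hab => ⟨hab.2, hab.1⟩).reverse_of_symmetric (s := Linked)
    (L := fun b => b ∈ smallLoops J X ω) (fun _ _ => Linked.symm) hγ
  have h4 := (h3.of_imp (p := fun a b => b ∈ smallLoops J X ω ∧ Linked a b)
    fun _ _ hab => ⟨hab.2, hab.1⟩).trans h2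
  refine crossesAll_of_chain hpos (fun i hi _ => by have := hi.1; omega) hγ₁ ⟨p, hp1, ?_⟩ h4
    fun hsub => ?_
  · rw [mem_sphere_zero_iff_norm] at hp4
    rw [mem_closedBall_zero_iff, hp4, levelScale_neg]
    have := pow_le_pow_right₀ (show (1 : ℝ) ≤ 16 by norm_num) hj
    linarith
  · have h5 := hsub hq2
    rw [mem_sphere_zero_iff_norm] at hqx
    rw [mem_ball_zero_iff, hqx, levelScale_neg] at h5
    linarith

theorem starArea_eq (p : PlanarCompact × Ω) :
    starArea J X p = surroundedArea (closure (clusterOf (insert p.1 (smallLoops J X p.2)) p.1)) := by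
  rw [starArea, filledCluster, surroundedArea, filling_closure_filling, surroundedArea]

theorem surroundedArea_le_starArea (p : PlanarCompact × Ω) :
    surroundedArea (p.1 : Set ℂ) ≤ starArea J X p := by
  rw [starArea_eq]
  refine surroundedArea_mono (Subset.trans ?_ subset_closure)
  exact subset_iUnion₂_of_subset p.1 Relation.ReflTransGen.refl Subset.rfl

end Cluster

/-! ### Measurability of the area of the filled cluster -/

/-- By compactness a single open thickening of some `K n` covers the closure. The right-hand side
involves only compact sets, hence measurable quantities. -/
theorem surroundedArea_closure_iUnion {K : ℕ → PlanarCompact} (hK : Monotone K)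
    (hb : Bornology.IsBounded (⋃ n, (K n : Set ℂ))) :
    surroundedArea (closure (⋃ n, (K n : Set ℂ))) =
      ⨅ k : ℕ, ⨆ n, surroundedArea (Metric.cthickening (1 / ((k : ℝ) + 1)) (K n : Set ℂ)) := by
  have hc : IsCompact (closure (⋃ n, (K n : Set ℂ))) := hb.isCompact_closure
  apply le_antisymm
  · refine le_iInf fun k => ?_
    have hk : 0 < 1 / ((k : ℝ) + 1) := by positivity
    obtain ⟨n, hn⟩ := hc.elim_directed_cover
      (fun n => Metric.thickening (1 / ((k : ℝ) + 1)) (K n : Set ℂ))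
      (fun n => Metric.isOpen_thickening) (by
        refine (Metric.closure_subset_thickening hk _).trans ?_
        rw [Metric.thickening_iUnion])
      (Monotone.directed_le fun m n h => Metric.thickening_subset_of_subset _ (hK h))
    exact le_iSup_of_le n (surroundedArea_mono
      (hn.trans (Metric.thickening_subset_cthickening _ _)))
  · rw [surroundedArea_eq_iInf hc]
    refine iInf_mono fun k => iSup_le fun n => surroundedArea_mono ?_
    exact Metric.cthickening_subset_of_subset _ 
      ((subset_iUnion (fun n => (K n : Set ℂ)) n).trans subset_closure)

section Measurability

variable {Ω : Type*} (J : Ω → Set ℕ) (X : ℕ → Ω → PlanarCompact)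

/-- The marked loop `γ` (index `none`) and the loops of the soup. -/
def markedLoop : Option ℕ → PlanarCompact × Ω → PlanarCompact
  | none, p => p.1
  | some j, p => X j p.2

/-- The indices of the loops of the configuration made of the marked loop and the small loops. -/
def IsMarkedIndex (p : PlanarCompact × Ω) : Option ℕ → Prop
  | none => True
  | some j => j ∈ J p.2 ∧ Metric.diam (X j p.2 : Set ℂ) < 1

/-- The loop of index `o` belongs to the cluster of the marked loop. -/
def Reached (p : PlanarCompact × Ω) (o : Option ℕ) : Prop :=
  Relation.ReflTransGen
    (fun a b => IsMarkedIndex J X p b ∧ Linked (markedLoop X a p) (markedLoop X b p)) none o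

open scoped Classical in
/-- The union of the marked loop and of the first `n` loops, restricted to those of its cluster. -/
noncomputable def partialCluster (p : PlanarCompact × Ω) : ℕ → PlanarCompact
  | 0 => p.1
  | n + 1 => if Reached J X p (some n) then partialCluster p n ⊔ X n p.2 else partialCluster p n

variable {J X}

/-- Chains of loops are replaced by chains of indices, which are countable in number. -/
theorem mem_chain_iff_reached {p : PlanarCompact × Ω} {γ : PlanarCompact} :
    Relation.ReflTransGen (fun a b => b ∈ insert p.1 (smallLoops J X p.2) ∧ Linked a b) p.1 γ ↔
      ∃ o, Reached J X p o ∧ markedLoop X o p = γ := by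
  constructor
  · intro h
    induction h with
    | refl => exact ⟨none, .refl, rfl⟩
    | @tail y z _ hyz ih =>
      obtain ⟨o, ho, rfl⟩ := ih
      obtain ⟨hz | ⟨⟨j, hj, rfl⟩, hd⟩, hl⟩ := hyz
      · subst hz
        exact ⟨none, ho.tail ⟨trivial, hl⟩, rfl⟩
      · exact ⟨some j, ho.tail ⟨⟨hj, hd⟩, hl⟩, rfl⟩
  · rintro ⟨o, ho, rfl⟩
    unfold Reached at ho
    induction ho with
    | refl => exact .refl
    | @tail a b _ hab ih =>
      refine ih.tail ⟨?_, hab.2⟩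
      cases b with
      | none => exact Or.inl rfl
      | some j => exact Or.inr ⟨⟨j, hab.1.1, rfl⟩, hab.1.2⟩

theorem mem_partialCluster_iff {p : PlanarCompact × Ω} {n : ℕ} {x : ℂ} :
    x ∈ (partialCluster J X p n : Set ℂ) ↔
      x ∈ (p.1 : Set ℂ) ∨ ∃ j < n, Reached J X p (some j) ∧ x ∈ (X j p.2 : Set ℂ) := by
  induction n with
  | zero => simp [partialCluster]
  | succ n ih =>
    rw [partialCluster]
    split_ifs with h
    · rw [NonemptyCompacts.coe_sup, mem_union, ih]
      constructor
      · rintro ((h1 | ⟨j, hj, h2⟩) | h1)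
        · exact Or.inl h1
        · exact Or.inr ⟨j, by omega, h2⟩
        · exact Or.inr ⟨n, by omega, h, h1⟩
      · rintro (h1 | ⟨j, hj, h2⟩)
        · exact Or.inl (Or.inl h1)
        · rcases Nat.lt_succ_iff_lt_or_eq.1 hj with hlt | rfl
          · exact Or.inl (Or.inr ⟨j, hlt, h2⟩)
          · exact Or.inr h2.2
    · rw [ih]
      refine or_congr_right ⟨fun ⟨j, hj, h2⟩ => ⟨j, by omega, h2⟩, fun ⟨j, hj, h2⟩ => ?_⟩
      rcases Nat.lt_succ_iff_lt_or_eq.1 hj with hlt | rfl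
      · exact ⟨j, hlt, h2⟩
      · exact absurd h2.1 h

theorem clusterOf_eq_iUnion (p : PlanarCompact × Ω) :
    clusterOf (insert p.1 (smallLoops J X p.2)) p.1 = ⋃ n, (partialCluster J X p n : Set ℂ) := by
  ext x
  simp only [clusterOf, mem_iUnion, mem_ofPred_eq, mem_chain_iff_reached, mem_partialCluster_iff,
    exists_prop]
  constructor
  · rintro ⟨_, ⟨o, ho, rfl⟩, hx⟩
    cases o with
    | none => exact ⟨0, Or.inl hx⟩
    | some j => exact ⟨j + 1, Or.inr ⟨j, by omega, ho, hx⟩⟩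
  · rintro ⟨n, hx | ⟨j, -, ho, hx⟩⟩
    · exact ⟨p.1, ⟨none, .refl, rfl⟩, hx⟩
    · exact ⟨_, ⟨some j, ho, rfl⟩, hx⟩

theorem monotone_partialCluster (p : PlanarCompact × Ω) : Monotone (partialCluster J X p) := by
  refine monotone_nat_of_le_succ fun n => ?_
  rw [partialCluster]
  split_ifs
  · exact le_sup_left
  · exact le_rfl

variable [MeasurableSpace Ω] {P : Measure Ω} {ν : Measure PlanarCompact}

theorem IsPoissonSoup.measurableSet_reached (h : IsPoissonSoup P ν J X) (o : Option ℕ) :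
    MeasurableSet {p | Reached J X p o} := by
  have hY : ∀ a, Measurable (markedLoop X a) := by
    rintro (_ | j)
    · exact measurable_fst
    · exact (h.measurable_curve j).comp measurable_snd
  have hV : ∀ a, MeasurableSet {p | IsMarkedIndex J X p a} := by
    rintro (_ | j)
    · exact MeasurableSet.univ
    · exact (measurable_snd (h.measurableSet_index j)).inter
        ((measurable_diam.comp (hY (some j))) measurableSet_Iio)
  exact measurableSet_reflTransGen
    (r := fun p a b => IsMarkedIndex J X p b ∧ Linked (markedLoop X a p) (markedLoop X b p))
    (fun a b => (hV b).inter (((hY a).prodMk (hY b)) measurableSet_setOf_linked)) none o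

theorem IsPoissonSoup.measurable_partialCluster (h : IsPoissonSoup P ν J X) (n : ℕ) :
    Measurable fun p => partialCluster J X p n := by
  induction n with
  | zero => exact measurable_fst
  | succ n ih =>
    simp only [partialCluster]
    exact Measurable.ite (h.measurableSet_reached (some n))
      (ih.sup ((h.measurable_curve n).comp measurable_snd)) ih

/-- The area of the filled cluster is almost everywhere measurable as soon as the cluster is
almost surely bounded. -/
theorem IsPoissonSoup.aemeasurable_starArea (h : IsPoissonSoup P ν J X)
    {m : Measure (PlanarCompact × Ω)}
    (hb : ∀ᵐ p ∂m, Bornology.IsBounded (clusterOf (insert p.1 (smallLoops J X p.2)) p.1)) :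
    AEMeasurable (starArea J X) m := by
  refine ⟨fun p => ⨅ k : ℕ, ⨆ n, surroundedArea
    (Metric.cthickening (1 / ((k : ℝ) + 1)) (partialCluster J X p n : Set ℂ)), ?_, ?_⟩
  · exact Measurable.iInf fun k => Measurable.iSup fun n =>
      (measurable_surroundedArea_cthickening (by positivity)).comp (h.measurable_partialCluster n)
  · filter_upwards [hb] with p hp
    rw [clusterOf_eq_iUnion] at hp
    rw [starArea_eq, clusterOf_eq_iUnion,
      surroundedArea_closure_iUnion (monotone_partialCluster p) hp]

end Measurability

/-! ### Crossing estimates for soups of small intensity -/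

/-- The decay factor of crossing probabilities from one scale to the next. -/
noncomputable def decayFactor : ℝ≥0∞ := ENNReal.ofReal ((16 ^ 4 : ℝ)⁻¹)

theorem decayFactor_lt_one : decayFactor < 1 := by
  rw [decayFactor, ENNReal.ofReal_lt_one]
  norm_num

/-- The intensity `a` of large loops near a point is small enough for the multiscale argument. -/
def IsSmallRate (a : ℝ≥0∞) : Prop := (4 * (discNet.card : ℝ≥0∞) ^ 2 + 2) * a ≤ decayFactor

/-- The coefficient `4 * N² + 2` is chosen to contain the three smallness conditions extracted here
and in the next two lemmas. -/
theorem IsSmallRate.two_mul_le {a : ℝ≥0∞} (h : IsSmallRate a) : 2 * a ≤ decayFactor :=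
  (mul_le_mul_left le_add_self a).trans h

theorem IsSmallRate.card_sq_mul_le {a : ℝ≥0∞} (h : IsSmallRate a) :
    (discNet.card : ℝ≥0∞) ^ 2 * (2 * a) ≤ decayFactor := by
  refine le_trans ?_ h
  calc (discNet.card : ℝ≥0∞) ^ 2 * (2 * a) = 2 * (discNet.card : ℝ≥0∞) ^ 2 * a := by ring
    _ ≤ (4 * (discNet.card : ℝ≥0∞) ^ 2 + 2) * a := by
      gcongr
      refine le_trans ?_ le_self_add
      gcongr
      norm_num

theorem IsSmallRate.card_sq_mul_sq_le {a : ℝ≥0∞} (h : IsSmallRate a) :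
    (discNet.card : ℝ≥0∞) ^ 2 * (2 * a) ^ 2 ≤ a := by
  calc (discNet.card : ℝ≥0∞) ^ 2 * (2 * a) ^ 2 = (4 * (discNet.card : ℝ≥0∞) ^ 2) * a * a := by ring
    _ ≤ (4 * (discNet.card : ℝ≥0∞) ^ 2 + 2) * a * a := by gcongr; exact le_self_add
    _ ≤ 1 * a := by gcongr; exact h.trans decayFactor_lt_one.le
    _ = a := one_mul a

theorem exists_isSmallRate {M : ℝ≥0∞} (hM : M ≠ ∞) :
    ∃ c₀ > 0, ∀ c : ℝ, c < c₀ → IsSmallRate (ENNReal.ofReal c * M) := by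
  have hB : (4 * (discNet.card : ℝ≥0∞) ^ 2 + 2) * M ≠ ∞ := by finiteness
  have ht : Tendsto (fun c : ℝ => ENNReal.ofReal c * ((4 * (discNet.card : ℝ≥0∞) ^ 2 + 2) * M))
      (𝓝 0) (𝓝 0) := by
    have h := ENNReal.Tendsto.mul_const (ENNReal.tendsto_ofReal (tendsto_id (α := ℝ) (x := 𝓝 0)))
      (Or.inr hB)
    simpa using h
  have hpos : 0 < decayFactor := by
    rw [decayFactor, ENNReal.ofReal_pos]
    positivity
  obtain ⟨c₀, hc₀, h⟩ := Metric.eventually_nhds_iff.1 (ht.eventually (gt_mem_nhds hpos))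
  refine ⟨c₀, hc₀, fun c hc => ?_⟩
  have key : ∀ d : ℝ, |d| < c₀ → IsSmallRate (ENNReal.ofReal d * M) := by
    intro d hd
    have h2 := (h (y := d) (by simpa using hd)).le
    unfold IsSmallRate
    rwa [mul_left_comm]
  rcases le_total 0 c with h0 | h0
  · exact key c (by rwa [abs_of_nonneg h0])
  · have := key 0 (by simpa using hc₀)
    rwa [ENNReal.ofReal_of_nonpos h0, ← ENNReal.ofReal_zero]

theorem setOf_crossesAll {Ω : Type*} (O : Ω → Set (ℤ × ℕ)) (n : ℤ) (w : ℂ) :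
    {ω | CrossesAll (O ω) n w} = ⋃ m : ℕ, {ω | Crosses (O ω) n m w} := by
  ext ω
  simp [CrossesAll]

section Estimates

variable {π : Measure PlanarCompact} [IsFiniteMeasure π] {Ω : Type*} [MeasurableSpace Ω]
  {P : Measure Ω} {J : Ω → Set ℕ} {X : ℕ → Ω → PlanarCompact} {c : ℝ}

/-- The intensity of the loops of a given level near a given point. -/
noncomputable def soupRate (π : Measure PlanarCompact) (c : ℝ) : ℝ≥0∞ :=
  ENNReal.ofReal c * levelMass π

theorem IsPoissonSoup.ae_diam_pos (hπ : IsShapeMeasure π)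
    (h : IsPoissonSoup P (ENNReal.ofReal c • soupMeasure π) J X) :
    ∀ᵐ ω ∂P, ∀ j ∈ J ω, 0 < Metric.diam (X j ω : Set ℂ) := by
  have h1 := h.measure_exists_le (measurable_diam (measurableSet_singleton 0))
  have h2 : P {ω | ∃ j ∈ J ω, Metric.diam (X j ω : Set ℂ) = 0} = 0 := by
    refine le_antisymm (h1.trans ?_) zero_le
    rw [Measure.smul_apply]
    have h3 := soupMeasure_diam_zero hπ
    exact (congrArg (ENNReal.ofReal c • ·) h3).trans_le (by simp)
  have h3 : ∀ᵐ ω ∂P, ¬ ∃ j ∈ J ω, Metric.diam (X j ω : Set ℂ) = 0 := by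
    rw [ae_iff]
    simpa using h2
  filter_upwards [h3] with ω hω j hj
  exact lt_of_le_of_ne Metric.diam_nonneg fun h0 => hω ⟨j, hj, h0.symm⟩

theorem IsPoissonSoup.measure_open_le (hπ : IsShapeMeasure π)
    (h : IsPoissonSoup P (ENNReal.ofReal c • soupMeasure π) J X) (n : ℤ) (w : ℂ) :
    P {ω | ∃ i ∈ openCells J X ω, i.1 = n ∧
      (cellDisc i ∩ Metric.closedBall w (2 * levelScale n)).Nonempty} ≤ soupRate π c :=
  h.measure_openCells_le (fun n w => by
    rw [Measure.smul_apply, smul_eq_mul, soupRate]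
    gcongr
    exact soupMeasure_level_le hπ n w) n w

theorem measure_crossesAll_le {O : Ω → Set (ℤ × ℕ)} {n : ℤ} {w : ℂ} {b : ℝ≥0∞}
    (hb : ∀ m : ℕ, P {ω | Crosses (O ω) n m w} ≤ b) : P {ω | CrossesAll (O ω) n w} ≤ b := by
  rw [setOf_crossesAll, Monotone.measure_iUnion]
  · exact iSup_le hb
  · intro m m' hm ω hω
    exact Crosses.mono hω (by exact_mod_cast hm)

theorem IsPoissonSoup.measurableSet_crossesAll {ν : Measure PlanarCompact}
    (h : IsPoissonSoup P ν J X) (n : ℤ) (w : ℂ) :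
    MeasurableSet {ω | CrossesAll (openCells J X ω) n w} := by
  rw [setOf_crossesAll]
  exact MeasurableSet.iUnion fun m => measurableSet_crosses h.measurableSet_mem_openCells n m w

theorem IsPoissonSoup.measure_crossesAll_neg_le (hπ : IsShapeMeasure π)
    (h : IsPoissonSoup P (ENNReal.ofReal c • soupMeasure π) J X)
    (hc : IsSmallRate (soupRate π c)) (j : ℕ) (w : ℂ) :
    P {ω | CrossesAll (openCells J X ω) (-(j : ℤ)) w} ≤ 2 * soupRate π c * decayFactor ^ j :=
  measure_crossesAll_le fun m => measure_crosses_neg_le h.measurableSet_mem_openCells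
    h.iIndep_openCells (fun _ _ hi => hi.1) decayFactor_lt_one.le (h.measure_open_le hπ)
    hc.card_sq_mul_sq_le hc.card_sq_mul_le j m w

theorem IsPoissonSoup.measure_crossesAll_le (hπ : IsShapeMeasure π)
    (h : IsPoissonSoup P (ENNReal.ofReal c • soupMeasure π) J X)
    (hc : IsSmallRate (soupRate π c)) (n : ℕ) (w : ℂ) :
    P {ω | CrossesAll (openCells J X ω) n w} ≤ 2 * soupRate π c :=
  _root_.measure_crossesAll_le fun m => (measure_mono fun _ hω => Crosses.mono hω (by omega)).trans
    (measure_crosses_le h.measurableSet_mem_openCells h.iIndep_openCells (h.measure_open_le hπ)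
      hc.card_sq_mul_sq_le m n w)

theorem IsPoissonSoup.measure_hasCrossingCluster_le [IsProbabilityMeasure P] (hπ : IsShapeMeasure π)
    (h : IsPoissonSoup P (ENNReal.ofReal c • soupMeasure π) J X)
    (hc : IsSmallRate (soupRate π c)) {x : ℝ} (hx : 4 < x) :
    P {ω | HasCrossingCluster (smallLoops J X ω) 4 x} ≤
      ENNReal.ofReal (32 ^ 4 * x ^ (-4 : ℤ)) := by
  have hx0 : 0 < x := by linarith
  have hxz : x ^ (-4 : ℤ) = (x ^ 4)⁻¹ := by
    rw [zpow_neg]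
    norm_cast
  -- Below `32` the right-hand side is at least `1`. Above, choose `2 * 16^j ≤ x < 32 * 16^j`, so
  -- that `16^(-4j) ≤ 32^4 * x^(-4)`.
  rcases lt_or_ge x 32 with hx32 | hx32
  · refine prob_le_one.trans ?_
    rw [ENNReal.one_le_ofReal, hxz, ← div_eq_mul_inv, one_le_div (by positivity)]
    gcongr
  · obtain ⟨j, hj1, hj2⟩ := exists_nat_pow_near (x := x / 2) (y := 16) (by linarith) (by norm_num)
    have hj : 1 ≤ j := by
      by_contra h0
      obtain rfl : j = 0 := by omega
      norm_num at hj2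
      linarith
    calc P {ω | HasCrossingCluster (smallLoops J X ω) 4 x}
        ≤ P {ω | CrossesAll (openCells J X ω) (-(j : ℤ)) 0} := by
          refine measure_mono_ae ?_
          filter_upwards [h.ae_diam_pos hπ] with ω hω hcr
          exact crossesAll_of_hasCrossingCluster hω hj (by linarith) hcr
      _ ≤ 2 * soupRate π c * decayFactor ^ j := h.measure_crossesAll_neg_le hπ hc j 0
      _ ≤ 1 * decayFactor ^ j := by
          gcongr
          exact hc.two_mul_le.trans decayFactor_lt_one.le
      _ = ENNReal.ofReal (((16 ^ 4 : ℝ)⁻¹) ^ j) := by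
          rw [one_mul, decayFactor, ENNReal.ofReal_pow (by positivity)]
      _ ≤ ENNReal.ofReal (32 ^ 4 * x ^ (-4 : ℤ)) := by
          refine ENNReal.ofReal_le_ofReal ?_
          have h1 : x ^ 4 ≤ (32 * 16 ^ j) ^ 4 := by
            gcongr
            rw [pow_succ] at hj2
            linarith
          rw [hxz, inv_pow, ← div_eq_mul_inv, inv_eq_one_div, div_le_div_iff₀ (by positivity)
            (by positivity), one_mul, ← pow_mul, mul_comm 4 j, pow_mul, ← mul_pow]
          exact h1

/-- Crossing probabilities tend to `0`, so the cluster of the marked loop is almost surely bounded.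
The shift `j + 1` makes the inner disc contain that loop, which lies in the disc of radius `2`. -/
theorem IsPoissonSoup.ae_exists_not_crossesAll (hπ : IsShapeMeasure π)
    (h : IsPoissonSoup P (ENNReal.ofReal c • soupMeasure π) J X)
    (hc : IsSmallRate (soupRate π c)) :
    ∀ᵐ ω ∂P, ∃ j : ℕ, ¬ CrossesAll (openCells J X ω) (-((j + 1 : ℕ) : ℤ)) 0 := by
  rw [ae_iff]
  refine le_antisymm (ge_of_tendsto' (x := atTop)
    (f := fun j : ℕ => 2 * soupRate π c * decayFactor ^ (j + 1)) ?_ fun j => ?_) zero_le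
  · have h1 := (ENNReal.tendsto_pow_atTop_nhds_zero_of_lt_one decayFactor_lt_one).comp
      (tendsto_add_atTop_nat 1)
    have h2 := ENNReal.Tendsto.const_mul (a := 2 * soupRate π c) h1
      (Or.inr (hc.two_mul_le.trans_lt (decayFactor_lt_one.trans ENNReal.one_lt_top)).ne)
    simpa using h2
  · refine (measure_mono fun ω hω => ?_).trans (h.measure_crossesAll_neg_le hπ hc (j + 1) 0)
    simp only [mem_ofPred_eq, not_exists, not_not] at hω
    exact hω j

/-- The area of the disc of radius `2 * 16 ^ (j + 1)`. -/
noncomputable def discArea (j : ℕ) : ℝ≥0∞ :=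
  volume (Metric.closedBall (0 : ℂ) (2 * 16 ^ (j + 1)))

theorem discArea_lt_top (j : ℕ) : discArea j < ∞ := measure_closedBall_lt_top

theorem discArea_eq (j : ℕ) : discArea j = ENNReal.ofReal (256 ^ j) * discArea 0 := by
  have h := Measure.addHaar_closedBall_mul (volume : Measure ℂ) 0 (r := 16 ^ j) (by positivity)
    (s := 32) (by norm_num)
  rw [Complex.finrank_real_complex, ← pow_mul, mul_comm j 2, pow_mul] at h
  rw [discArea, discArea, show (2 : ℝ) * 16 ^ (j + 1) = 16 ^ j * 32 by ring, h]
  norm_num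

/-- The exponent `4` beats the dimension `2`: each scale contributes a factor `256 / 16^4 = 1 /
256`. -/
theorem tsum_decayFactor_mul_discArea_lt_top :
    ∑' j : ℕ, decayFactor ^ (j + 1) * discArea (j + 1) < ∞ := by
  have h (j : ℕ) : decayFactor ^ (j + 1) * discArea (j + 1) =
      (ENNReal.ofReal (1 / 256)) ^ (j + 1) * discArea 0 := by
    rw [discArea_eq, decayFactor, ← mul_assoc, ← ENNReal.ofReal_pow (by positivity),
      ← ENNReal.ofReal_mul (by positivity), ← mul_pow, ← ENNReal.ofReal_pow (by positivity)]
    norm_num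
  have h1 : ENNReal.ofReal (1 / 256) < 1 := by
    rw [ENNReal.ofReal_lt_one]
    norm_num
  simp_rw [h]
  rw [ENNReal.tsum_mul_right, ENNReal.tsum_geometric_add_one]
  refine ENNReal.mul_lt_top (ENNReal.mul_lt_top ENNReal.ofReal_lt_top ?_) (discArea_lt_top 0)
  exact ENNReal.inv_lt_top.2 (tsub_pos_of_lt h1)

/-! ### Upper bounds for the area of the filled cluster. -/

theorem surroundedArea_closure_le_discArea {S : Set ℂ} {j : ℕ}
    (hS : S ⊆ Metric.ball 0 (2 * 16 ^ (j + 1))) : surroundedArea (closure S) ≤ discArea j :=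
  measure_mono (filling_subset_closedBall (by positivity)
    (closure_minimal (hS.trans Metric.ball_subset_closedBall) Metric.isClosed_closedBall))

theorem closedBall_two_subset (j : ℕ) :
    Metric.closedBall (0 : ℂ) 2 ⊆ Metric.closedBall 0 (16 ^ (j + 1)) := by
  refine Metric.closedBall_subset_closedBall ?_
  have := one_le_pow₀ (show (1 : ℝ) ≤ 16 by norm_num) (n := j)
  rw [pow_succ]
  linarith

theorem exists_net (n : ℕ) : ∃ T : Finset ℂ, (T : Set ℂ) ⊆ Metric.closedBall 0 2 ∧
    Metric.closedBall (0 : ℂ) 2 ⊆ ⋃ t ∈ (T : Set ℂ), Metric.ball t (levelScale n) := by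
  obtain ⟨t, ht, hf, hc⟩ := (isCompact_closedBall (0 : ℂ) 2).finite_cover_balls (levelScale_pos n)
  exact ⟨hf.toFinset, by simpa using ht, by simpa using hc⟩

/-- A net of the disc of radius `2` at scale `16 ^ (-n)`. -/
noncomputable def fineNet (n : ℕ) : Finset ℂ := (exists_net n).choose

/-- The event that, at scale `16 ^ (-n)`, the cluster of the marked loop may leave a neighborhood
of this loop. -/
def badEvent (J : Ω → Set ℕ) (X : ℕ → Ω → PlanarCompact) (n : ℕ) : Set Ω :=
  {ω | ∃ j ∈ J ω, X j ω ∈ meetingLoops (levelScale n) 1 0 10} ∪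
    ⋃ t ∈ fineNet n, {ω | CrossesAll (openCells J X ω) n t}

theorem IsPoissonSoup.measurableSet_badEvent {ν : Measure PlanarCompact}
    (h : IsPoissonSoup P ν J X) (n : ℕ) : MeasurableSet (badEvent J X n) :=
  (h.measurableSet_exists (measurableSet_meetingLoops _ _ _ _)).union
    (Finset.measurableSet_biUnion _ fun t _ => h.measurableSet_crossesAll n t)

/-- The rate of decay of the probability of `badEvent` as the intensity vanishes. -/
noncomputable def badRate (π : Measure PlanarCompact) (n : ℕ) : ℝ≥0∞ :=
  soupMeasure π (meetingLoops (levelScale n) 1 0 10) + (fineNet n).card * (2 * levelMass π)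

theorem badRate_lt_top (hπ : IsShapeMeasure π) (n : ℕ) : badRate π n < ∞ := by
  refine ENNReal.add_lt_top.2 ⟨?_, ?_⟩
  · refine (soupMeasure_meetingLoops_le hπ (levelScale_pos n) 0 (by norm_num)).trans_lt ?_
    exact ENNReal.mul_lt_top measure_closedBall_lt_top
      (ENNReal.mul_lt_top ENNReal.ofReal_lt_top (measure_lt_top _ _))
  · exact ENNReal.mul_lt_top (ENNReal.natCast_lt_top _)
      (ENNReal.mul_lt_top (by finiteness) levelMass_lt_top)

theorem IsPoissonSoup.measure_badEvent_le (hπ : IsShapeMeasure π)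
    (h : IsPoissonSoup P (ENNReal.ofReal c • soupMeasure π) J X)
    (hc : IsSmallRate (soupRate π c)) (n : ℕ) :
    P (badEvent J X n) ≤ ENNReal.ofReal c * badRate π n := by
  refine (measure_union_le _ _).trans ?_
  rw [badRate, mul_add]
  refine add_le_add (h.measure_exists_le (measurableSet_meetingLoops _ _ _ _)) ?_
  refine (measure_biUnion_finset_le _ _).trans ?_
  calc ∑ t ∈ fineNet n, P {ω | CrossesAll (openCells J X ω) n t}
      ≤ ∑ t ∈ fineNet n, 2 * soupRate π c :=
        Finset.sum_le_sum fun t _ => h.measure_crossesAll_le hπ hc n t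
    _ = _ := by
        rw [Finset.sum_const, nsmul_eq_mul, soupRate]
        ring

/-- Split according to the first scale without crossing. If it is the smallest one, either the
cluster stays near `γ` or the bad event pays for a fixed disc; otherwise the crossing at the
preceding scale pays for the disc that contains the cluster. -/
theorem starArea_le {Ω : Type*} {J : Ω → Set ℕ} {X : ℕ → Ω → PlanarCompact} {ω : Ω}
    (hpos : ∀ j ∈ J ω, 0 < Metric.diam (X j ω : Set ℂ))
    (hj : ∃ j : ℕ, ¬ CrossesAll (openCells J X ω) (-((j + 1 : ℕ) : ℤ)) 0) (n : ℕ)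
    {γ : PlanarCompact} (hγ : (γ : Set ℂ) ⊆ Metric.closedBall 0 2) :
    starArea J X (γ, ω) ≤ surroundedArea (Metric.cthickening (3 * levelScale n) (γ : Set ℂ)) +
      ((badEvent J X n).indicator (fun _ => discArea 0) ω +
        ∑' j : ℕ, {ω | CrossesAll (openCells J X ω) (-((j + 1 : ℕ) : ℤ)) 0}.indicator
          (fun _ => discArea (j + 1)) ω) := by
  classical
  have hk := Nat.find_spec hj
  have hmin := fun m => Nat.find_min hj (m := m)
  generalize Nat.find hj = k at hk hmin
  have hball := clusterOf_subset_ball hpos hk (hγ.trans (closedBall_two_subset k))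
  rw [starArea_eq]
  rcases k with _ | k
  · by_cases hbad : ω ∈ badEvent J X n
    · rw [indicator_of_mem hbad]
      exact (surroundedArea_closure_le_discArea hball).trans
        (le_self_add.trans le_add_self)
    · refine le_trans (surroundedArea_mono (closure_minimal ?_ Metric.isClosed_cthickening))
        le_self_add
      simp only [badEvent, mem_union, mem_ofPred_eq, mem_iUnion, not_or, not_exists] at hbad
      obtain ⟨hT1, hT2⟩ := (exists_net n).choose_spec
      refine clusterOf_subset_cthickening hpos hT1 hT2 (fun t ht => hbad.2 t ht)
        (by simpa using hbad.1) hγ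
  · have hcr := not_not.1 (hmin k (by omega))
    refine (surroundedArea_closure_le_discArea hball).trans (le_trans ?_ le_add_self)
    refine le_trans ?_ le_add_self
    refine le_trans ?_ (ENNReal.le_tsum k)
    rw [indicator_of_mem (s := {ω | CrossesAll (openCells J X ω) (-((k + 1 : ℕ) : ℤ)) 0}) hcr]

theorem ae_prod_good [IsProbabilityMeasure P] (hπ : IsShapeMeasure π)
    (h : IsPoissonSoup P (ENNReal.ofReal c • soupMeasure π) J X)
    (hc : IsSmallRate (soupRate π c)) : ∀ᵐ p ∂(π.prod P),
      (p.1 : Set ℂ) ⊆ Metric.closedBall 0 2 ∧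
      (∀ j ∈ J p.2, 0 < Metric.diam (X j p.2 : Set ℂ)) ∧
      ∃ j : ℕ, ¬ CrossesAll (openCells J X p.2) (-((j + 1 : ℕ) : ℤ)) 0 := by
  have h1 := Measure.quasiMeasurePreserving_fst.ae (μa := π.prod P) hπ
  have h2 := Measure.quasiMeasurePreserving_snd.ae (μa := π.prod P)
    ((h.ae_diam_pos hπ).and (h.ae_exists_not_crossesAll hπ hc))
  filter_upwards [h1, h2] with p hp1 hp2
  exact ⟨fun w hw => by simpa using norm_le_two_of_mem_square (hp1.2.2 hw), hp2⟩

theorem IsPoissonSoup.aemeasurable_starArea_prod [IsProbabilityMeasure P] (hπ : IsShapeMeasure π)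
    (h : IsPoissonSoup P (ENNReal.ofReal c • soupMeasure π) J X)
    (hc : IsSmallRate (soupRate π c)) : AEMeasurable (starArea J X) (π.prod P) := by
  refine h.aemeasurable_starArea ?_
  filter_upwards [ae_prod_good hπ h hc] with p ⟨hp1, hp2, j, hj⟩
  exact Metric.isBounded_ball.subset
    (clusterOf_subset_ball hp2 hj (hp1.trans (closedBall_two_subset j)))

/-- The rate of convergence of the mean area as the intensity vanishes. -/
noncomputable def errorRate (π : Measure PlanarCompact) (n : ℕ) : ℝ≥0∞ :=
  π univ * (badRate π n * discArea 0 +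
    2 * levelMass π * ∑' j : ℕ, decayFactor ^ (j + 1) * discArea (j + 1))

theorem errorRate_lt_top (hπ : IsShapeMeasure π) (n : ℕ) : errorRate π n < ∞ :=
  ENNReal.mul_lt_top (measure_lt_top _ _) (ENNReal.add_lt_top.2
    ⟨ENNReal.mul_lt_top (badRate_lt_top hπ n) (discArea_lt_top 0),
      ENNReal.mul_lt_top (ENNReal.mul_lt_top (by finiteness) levelMass_lt_top)
        tsum_decayFactor_mul_discArea_lt_top⟩)

theorem IsPoissonSoup.meanStarArea_le [IsProbabilityMeasure P] (hπ : IsShapeMeasure π)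
    (h : IsPoissonSoup P (ENNReal.ofReal c • soupMeasure π) J X)
    (hc : IsSmallRate (soupRate π c)) (n : ℕ) :
    meanStarArea π P J X ≤
      ∫⁻ γ, surroundedArea (Metric.cthickening (3 * levelScale n) (γ : Set ℂ)) ∂π +
        ENNReal.ofReal c * errorRate π n := by
  have hf : Measurable fun p : PlanarCompact × Ω =>
      surroundedArea (Metric.cthickening (3 * levelScale n) (p.1 : Set ℂ)) :=
    (measurable_surroundedArea_cthickening
      (mul_nonneg (by norm_num : (0 : ℝ) ≤ 3) (levelScale_pos n).le)).comp measurable_fst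
  set g : Ω → ℝ≥0∞ := fun ω => (badEvent J X n).indicator (fun _ => discArea 0) ω +
    ∑' j : ℕ, {ω | CrossesAll (openCells J X ω) (-((j + 1 : ℕ) : ℤ)) 0}.indicator
      (fun _ => discArea (j + 1)) ω with hg
  have hm1 : Measurable ((badEvent J X n).indicator fun _ => discArea 0) :=
    measurable_const.indicator (h.measurableSet_badEvent n)
  have hm2 (j : ℕ) : Measurable ({ω | CrossesAll (openCells J X ω) (-((j + 1 : ℕ) : ℤ)) 0}.indicator
      fun _ => discArea (j + 1)) :=
    measurable_const.indicator (h.measurableSet_crossesAll _ 0)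
  have hgm : Measurable g := hm1.add (Measurable.tsum hm2)
  have hgi : ∫⁻ ω, g ω ∂P ≤ ENNReal.ofReal c * (badRate π n * discArea 0 +
      2 * levelMass π * ∑' j : ℕ, decayFactor ^ (j + 1) * discArea (j + 1)) := by
    rw [hg, lintegral_add_left hm1, lintegral_tsum fun j => (hm2 j).aemeasurable, mul_add]
    refine add_le_add ?_ ?_
    · rw [lintegral_indicator_const (h.measurableSet_badEvent n), ← mul_assoc,
        mul_comm (discArea 0)]
      gcongr
      exact h.measure_badEvent_le hπ hc n
    · rw [← mul_assoc, ← ENNReal.tsum_mul_left]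
      refine ENNReal.tsum_le_tsum fun j => ?_
      rw [lintegral_indicator_const (h.measurableSet_crossesAll _ 0), mul_comm, ← mul_assoc]
      gcongr
      refine (h.measure_crossesAll_neg_le hπ hc (j + 1) 0).trans_eq ?_
      rw [soupRate]
      ring
  calc meanStarArea π P J X
      ≤ ∫⁻ p, (surroundedArea (Metric.cthickening (3 * levelScale n) (p.1 : Set ℂ)) + g p.2)
          ∂(π.prod P) := by
        refine lintegral_mono_ae ?_
        filter_upwards [ae_prod_good hπ h hc] with p ⟨hp1, hp2, hp3⟩
        exact starArea_le hp2 hp3 n hp1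
    _ = ∫⁻ γ, surroundedArea (Metric.cthickening (3 * levelScale n) (γ : Set ℂ)) ∂π +
          π univ * ∫⁻ ω, g ω ∂P := by
        rw [lintegral_add_left hf]
        congr 1
        · rw [lintegral_prod _ hf.aemeasurable]
          simp
        · rw [lintegral_prod (fun p : PlanarCompact × Ω => g p.2) (hgm.comp measurable_snd).aemeasurable]
          simp [mul_comm]
    _ ≤ _ := by
        rw [errorRate, mul_left_comm]
        gcongr

/-! ### Comparison with the mean area of a single loop. -/

theorem meanArea_le_meanStarArea {π : Measure PlanarCompact} [SFinite π]
    [IsProbabilityMeasure P] : meanArea π ≤ meanStarArea π P J X := by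
  calc meanArea π = ∫⁻ p, surroundedArea (p.1 : Set ℂ) ∂(π.prod P) := by
        rw [lintegral_prod (fun p : PlanarCompact × Ω => surroundedArea (p.1 : Set ℂ))
          (measurable_surroundedArea.comp measurable_fst).aemeasurable]
        simp [meanArea]
    _ ≤ _ := lintegral_mono fun p => surroundedArea_le_starArea p

theorem surroundedArea_cthickening_le {γ : PlanarCompact}
    (hγ : (γ : Set ℂ) ⊆ Metric.closedBall 0 2) {δ : ℝ} (hδ0 : 0 ≤ δ) (hδ : δ ≤ 1) :
    surroundedArea (Metric.cthickening δ (γ : Set ℂ)) ≤ volume (Metric.closedBall (0 : ℂ) 3) := by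
  refine measure_mono (filling_subset_closedBall (by norm_num) ?_)
  refine (Metric.cthickening_subset_of_subset δ hγ).trans ?_
  rw [cthickening_closedBall hδ0 (by norm_num)]
  exact Metric.closedBall_subset_closedBall (by linarith)

theorem ae_subset_closedBall {π : Measure PlanarCompact} (hπ : IsShapeMeasure π) :
    ∀ᵐ γ : PlanarCompact ∂π, (γ : Set ℂ) ⊆ Metric.closedBall 0 2 := by
  filter_upwards [hπ] with γ hγ w hw
  simpa using norm_le_two_of_mem_square (hγ.2.2 hw)

theorem lintegral_surroundedArea_cthickening_lt_top (hπ : IsShapeMeasure π) {δ : ℝ} (hδ0 : 0 ≤ δ)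
    (hδ : δ ≤ 1) : ∫⁻ γ, surroundedArea (Metric.cthickening δ (γ : Set ℂ)) ∂π < ∞ := by
  calc ∫⁻ γ, surroundedArea (Metric.cthickening δ (γ : Set ℂ)) ∂π
      ≤ ∫⁻ _, volume (Metric.closedBall (0 : ℂ) 3) ∂π := by
        refine lintegral_mono_ae ?_
        filter_upwards [ae_subset_closedBall hπ] with γ hγ
        exact surroundedArea_cthickening_le hγ hδ0 hδ
    _ < ∞ := by
        rw [lintegral_const]
        exact ENNReal.mul_lt_top measure_closedBall_lt_top (measure_lt_top _ _)

theorem tendsto_lintegral_surroundedArea_cthickening (hπ : IsShapeMeasure π) :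
    Tendsto (fun k : ℕ => ∫⁻ γ, surroundedArea
      (Metric.cthickening (1 / ((k : ℝ) + 1)) (γ : Set ℂ)) ∂π) atTop (𝓝 (meanArea π)) := by
  refine tendsto_lintegral_of_dominated_convergence
    (fun _ => volume (Metric.closedBall (0 : ℂ) 3))
    (fun k => measurable_surroundedArea_cthickening (by positivity)) (fun k => ?_) ?_ ?_
  · filter_upwards [ae_subset_closedBall hπ] with γ hγ
    refine surroundedArea_cthickening_le hγ (by positivity) ?_
    rw [div_le_one (by positivity)]
    linarith [Nat.cast_nonneg (α := ℝ) k]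
  · rw [lintegral_const]
    exact (ENNReal.mul_lt_top measure_closedBall_lt_top (measure_lt_top _ _)).ne
  · exact Eventually.of_forall fun γ => tendsto_surroundedArea_cthickening γ.isCompact

theorem exists_levelScale_le {δ : ℝ} (hδ : 0 < δ) : ∃ n : ℕ, 3 * levelScale n ≤ δ := by
  obtain ⟨n, hn⟩ := exists_pow_lt_of_lt_one (show 0 < δ / 3 by positivity)
    (show (16 : ℝ)⁻¹ < 1 by norm_num)
  refine ⟨n, ?_⟩
  rw [levelScale, zpow_neg, zpow_natCast, ← inv_pow]
  linarith

end Estimates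

theorem mainTheorem7 (π : Measure PlanarCompact) [IsFiniteMeasure π] (hπ : IsShapeMeasure π)
    {Ω : ℝ → Type*} [∀ c, MeasurableSpace (Ω c)] (P : ∀ c, Measure (Ω c))
    [∀ c, IsProbabilityMeasure (P c)]
    (J : ∀ c, Ω c → Set ℕ) (X : ∀ c, ℕ → Ω c → PlanarCompact)
    (hsoup : ∀ c, 0 < c →
      IsPoissonSoup (P c) (ENNReal.ofReal c • soupMeasure π) (J c) (X c)) :
    (∃ c₀ > 0, ∀ c, 0 < c → c < c₀ →
      AEMeasurable (starArea (J c) (X c)) (π.prod (P c)) ∧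
        meanStarArea π (P c) (J c) (X c) < ∞) ∧
    (meanArea π < ∞ ∧
      Tendsto (fun c => meanStarArea π (P c) (J c) (X c)) (𝓝[>] 0) (𝓝 (meanArea π))) ∧
    (∃ c₁ > 0, ∃ k : ℝ, ∀ c, 0 < c → c < c₁ → ∀ x : ℝ, 4 < x →
      P c {ω | HasCrossingCluster (smallLoops (J c) (X c) ω) 4 x} ≤
        ENNReal.ofReal (k * x ^ (-4 : ℤ))) := by
  obtain ⟨c₀, hc₀, hsmall⟩ := exists_isSmallRate (levelMass_lt_top (π := π)).ne
  have hupper (c : ℝ) (hc : 0 < c) (hcc : c < c₀) {δ : ℝ} (n : ℕ) (hn : 3 * levelScale n ≤ δ) :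
      meanStarArea π (P c) (J c) (X c) ≤
        ∫⁻ γ, surroundedArea (Metric.cthickening δ (γ : Set ℂ)) ∂π +
          ENNReal.ofReal c * errorRate π n :=
    ((hsoup c hc).meanStarArea_le hπ (hsmall c hcc) n).trans
      (add_le_add (lintegral_mono fun γ => surroundedArea_mono (Metric.cthickening_mono hn _)) le_rfl)
  refine ⟨⟨c₀, hc₀, fun c hc hcc => ⟨(hsoup c hc).aemeasurable_starArea_prod hπ (hsmall c hcc), ?_⟩⟩,
    ⟨?_, ?_⟩, ⟨c₀, hc₀, 32 ^ 4, fun c hc hcc x hx =>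
      (hsoup c hc).measure_hasCrossingCluster_le hπ (hsmall c hcc) hx⟩⟩
  · obtain ⟨n, hn⟩ := exists_levelScale_le one_pos
    exact (hupper c hc hcc n hn).trans_lt (ENNReal.add_lt_top.2
      ⟨lintegral_surroundedArea_cthickening_lt_top hπ zero_le_one le_rfl,
        ENNReal.mul_lt_top ENNReal.ofReal_lt_top (errorRate_lt_top hπ n)⟩)
  · refine lt_of_le_of_lt (lintegral_mono fun γ => surroundedArea_mono ?_)
      (lintegral_surroundedArea_cthickening_lt_top hπ zero_le_one le_rfl)
    exact Metric.self_subset_cthickening _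
  · refine tendsto_order.2 ⟨fun a ha => Eventually.of_forall fun c =>
      ha.trans_le meanArea_le_meanStarArea, fun b hb => ?_⟩
    -- The thickening is fixed first, then a scale `n` finer than it; with both fixed the error `c *
    -- errorRate π n` vanishes with `c`.
    obtain ⟨k, hk⟩ := ((tendsto_lintegral_surroundedArea_cthickening hπ).eventually
      (gt_mem_nhds hb)).exists
    obtain ⟨n, hn⟩ := exists_levelScale_le (show 0 < 1 / ((k : ℝ) + 1) by positivity)
    have ht : Tendsto (fun c : ℝ => ∫⁻ γ, surroundedArea
        (Metric.cthickening (1 / ((k : ℝ) + 1)) (γ : Set ℂ)) ∂π +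
          ENNReal.ofReal c * errorRate π n) (𝓝[>] 0) (𝓝 (∫⁻ γ, surroundedArea
        (Metric.cthickening (1 / ((k : ℝ) + 1)) (γ : Set ℂ)) ∂π)) := by
      have h1 := ENNReal.Tendsto.mul_const (ENNReal.tendsto_ofReal
        (tendsto_id.mono_left (nhdsWithin_le_nhds (a := (0 : ℝ)) (s := Ioi 0))))
        (Or.inr (errorRate_lt_top hπ n).ne)
      have h2 := h1.const_add (∫⁻ γ, surroundedArea
        (Metric.cthickening (1 / ((k : ℝ) + 1)) (γ : Set ℂ)) ∂π)
      simpa using h2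
    filter_upwards [ht.eventually (gt_mem_nhds hk), self_mem_nhdsWithin,
      nhdsWithin_le_nhds (gt_mem_nhds hc₀)] with c h1 h2 h3
    exact (hupper c h2 h3 n hn).trans_lt h1
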